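/- Let $k\ge 1$, let $Q$ be an inner product on $\mathbb C^k$ that is real-valued on $\mathbb R^k\times\mathbb R^k$, put $\|z\|=\sqrt{Q(z,z)}$ and let $B_{1/n}=\{z\in\mathbb C^k : \|z\|<1/n\}$ for $n\in\mathbb N=\{1,2,\dots\}$. Let $\mathcal L$ be a nonempty countable set of nonzero linear forms $\mathbb C^k\to\mathbb C$ with real coefficients (i.e. mapping $\mathbb R^k$ to $\mathbb R$), and let $\mathcal S_{\mathcal L}=\{L_1\cdots L_m : m\ge 1,\ L_i\in\mathcal L\}$. Order $\mathcal S_{\mathcal L}$ by $P\preceq R$ iff $R=P$ or $R=SP$ for some $S\in\mathcal S_{\mathcal L}$, and order $\mathbb N\times\mathcal S_{\mathcal L}$ by the product order. Let $\mathrm{BHol}^{\mathbb C}(B_{1/n})$ be the complex Banach space of bounded holomorphic functions on $B_{1/n}$ with the supremum norm, and $\mathrm{BHol}(B_{1/n})$ its real subspace of functions that are real on $B_{1/n}\cap\mathbb R^k$. For $P\in\mathcal S_{\mathcal L}$ let $\mathrm{Mer}^{\mathbb C}_P(B_{1/n})=\{f/P : f\in \mathrm{BHol}^{\mathbb C}(B_{1/n})\}$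 (functions on $\{z\in B_{1/n}: P(z)\neq0\}$) with the norm $\|f/P\|=\|f\|_\infty$, and let $\mathrm{Mer}_P(B_{1/n})=\{f/P : f\in \mathrm{BHol}(B_{1/n})\}$ be its real subspace. Restriction of functions gives inclusions $\mathrm{Mer}^{\mathbb C}_P(B_{1/n})\to \mathrm{Mer}^{\mathbb C}_R(B_{1/m})$ and $\mathrm{Mer}_P(B_{1/n})\to \mathrm{Mer}_R(B_{1/m})$ for $(n,P)\le(m,R)$, and $\mathrm{BHol}^{\mathbb C}(B_{1/n})\to\mathrm{BHol}^{\mathbb C}(B_{1/m})$, $\mathrm{BHol}(B_{1/n})\to\mathrm{BHol}(B_{1/m})$ for $n\le m$. Form the locally convex inductive limits $$\mathcal M^{\mathbb C}_{\mathcal L}(\mathbb C^k)=\varinjlim_{(n,P)}\mathrm{Mer}^{\mathbb C}_P(B_{1/n}),\quad \mathcal M_{\mathcal L}(\mathbb C^k)=\varinjlim_{(n,P)}\mathrm{Mer}_P(B_{1/n}),$$ $$\mathcal H^{\mathbb C}(\mathbb C^k)=\varinjlim_n\mathrm{BHol}^{\mathbb C}(B_{1/n}),\quad \mathcal H(\mathbb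 C^k)=\varinjlim_n\mathrm{BHol}(B_{1/n}),$$ over $\mathbb C$, $\mathbb R$, $\mathbb C$, $\mathbb R$ respectively, i.e. the algebraic direct limits with the finest locally convex topology making all canonical maps from the steps continuous. A Silva space is a locally convex space that is the locally convex inductive limit of an increasing sequence of Banach spaces whose inclusion maps are compact. Then: 1. $\mathcal M^{\mathbb C}_{\mathcal L}(\mathbb C^k)$ and $\mathcal M_{\mathcal L}(\mathbb C^k)$ are Hausdorff and complete, and are Silva spaces (over $\mathbb C$ and $\mathbb R$ respectively). Their elements are determined by their germs (two functions having the same germ if they agree on $U\cap\{P\ne0\}$ for some neighbourhood $U$ of $0$ and some $P\in\mathcal S_{\mathcal L}$); these germs contain $1$ and are closed under pointwise multiplication, and pointwise multiplication is a (jointly) continuous bilinear map, making both spaces locally convex algebras. 2. $\mathcal H^{\mathbb C}(\mathbb C^k)$ and $\mathcal H(\mathbb C^k)$ are Silva spaces (over $\mathbb C$ and $\mathbb R$ respectively), and the canonical linear maps $\mathcal H^{\mathbb C}(\mathbb C^k)\to\mathcal M^{\mathbb C}_{\mathcal L}(\mathbb C^k)$ and $\mathcal H(\mathbb C^k)\to\mathcal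 M_{\mathcal L}(\mathbb C^k)$, which send the class of $f$ to the element with the germ of $f$, are well defined, continuous and injective. -/

import Mathlib

open Filter Topology BoundedContinuousFunction
open TopologicalSpace (Opens)

noncomputable section

namespace SilvaGerms

/-! ### Locally convex inductive limits and Silva spaces -/

section Abstract

universe u v w

/-- The locally convex final topology of linear maps `f i : X i → E`: the topology defined by all
seminorms `p` on `E` such that every `p ∘ f i` is continuous. It is the finest locally convex
vector space topology on `E` for which all `f i` are continuous. -/
@[reducible] def lcFinal (𝕜 : Type w) [RCLike 𝕜] {ι : Type v} {X : ι → Type u} {E : Type*}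
    [∀ i, AddCommGroup (X i)] [∀ i, Module 𝕜 (X i)] [∀ i, TopologicalSpace (X i)]
    [AddCommGroup E] [Module 𝕜 E] (f : ∀ i, X i →ₗ[𝕜] E) : TopologicalSpace E :=
  SeminormFamily.moduleFilterBasis (𝕜 := 𝕜) (F := E)
    (ι := {p : Seminorm 𝕜 E // ∀ i, Continuous fun x => p (f i x)}) (fun p => p.1) |>.topology

variable (𝕜 : Type w) [RCLike 𝕜] {ι : Type v} [Preorder ι] (X : ι → Type u)
  [∀ i, NormedAddCommGroup (X i)] [∀ i, NormedSpace 𝕜 (X i)]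
  (b : ∀ i j, i ≤ j → X i →ₗ[𝕜] X j)

open Classical in
/-- The locally convex inductive limit of an inductive system of normed spaces: the algebraic
direct limit with the finest locally convex topology making all canonical maps continuous. -/
def LCLim : Type (max u v) := Module.DirectLimit X b

namespace LCLim

open Classical in
instance : AddCommGroup (LCLim 𝕜 X b) :=
  inferInstanceAs (AddCommGroup (Module.DirectLimit X b))

open Classical in
instance : Module 𝕜 (LCLim 𝕜 X b) :=
  inferInstanceAs (Module 𝕜 (Module.DirectLimit X b))

open Classical in
/-- The canonical map of a step into the limit. -/
def of (i : ι) : X i →ₗ[𝕜] LCLim 𝕜 X b := Module.DirectLimit.of 𝕜 ι X b i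

open Classical in
/-- The linear map on the limit induced by a compatible family of linear maps on the steps. -/
def lift {G : Type*} [AddCommGroup G] [Module 𝕜 G] (g : ∀ i, X i →ₗ[𝕜] G)
    (hg : ∀ i j hij x, g j (b i j hij x) = g i x) : LCLim 𝕜 X b →ₗ[𝕜] G :=
  Module.DirectLimit.lift 𝕜 ι X b g hg

instance : TopologicalSpace (LCLim 𝕜 X b) := lcFinal 𝕜 (of 𝕜 X b)

theorem withSeminorms : WithSeminorms (𝕜 := 𝕜) (E := LCLim 𝕜 X b)
    (ι := {p : Seminorm 𝕜 (LCLim 𝕜 X b) // ∀ i, Continuous fun x => p (of 𝕜 X b i x)})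
    (fun p => p.1) := ⟨rfl⟩

instance : IsTopologicalAddGroup (LCLim 𝕜 X b) := (withSeminorms 𝕜 X b).topologicalAddGroup
instance : ContinuousSMul 𝕜 (LCLim 𝕜 X b) := (withSeminorms 𝕜 X b).continuousSMul

end LCLim

/-- `E` is a Silva space over `𝕜`: it is the union of an increasing sequence of Banach spaces `Y n`
with compact inclusions, and carries the locally convex inductive limit topology. -/
def IsSilva (E : Type u) [AddCommGroup E] [Module 𝕜 E] [t : TopologicalSpace E] : Prop :=
  ∃ (Y : ℕ → Type u) (_ : ∀ n, NormedAddCommGroup (Y n)) (_ : ∀ n, NormedSpace 𝕜 (Y n))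
    (_ : ∀ n, CompleteSpace (Y n)) (c : ∀ n, Y n →L[𝕜] Y (n + 1)) (f : ∀ n, Y n →ₗ[𝕜] E),
    (∀ n, IsCompactOperator (c n)) ∧
    (∀ n, Function.Injective (f n)) ∧
    (∀ n y, f (n + 1) (c n y) = f n y) ∧
    (∀ x, ∃ n y, f n y = x) ∧
    t = lcFinal 𝕜 f

/-- Completeness for the uniform structure of a topological vector space. -/
def IsCompleteTVS (E : Type u) [AddCommGroup E] [TopologicalSpace E] [IsTopologicalAddGroup E] :
    Prop :=
  letI := IsTopologicalAddGroup.rightUniformSpace E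
  CompleteSpace E

/-- The topological vector space `E`, whose elements represent germs of functions along the
filter `l` through `γ`, is a locally convex algebra under pointwise multiplication: `E` is locally
convex, distinct elements have distinct germs, the germs of elements of `E` contain `1` and are
stable under products, and the resulting bilinear multiplication `E × E → E` is
(jointly) continuous. -/
def IsPointwiseLCAlgebra {E : Type u} [AddCommGroup E] [Module 𝕜 E] [TopologicalSpace E]
    {α : Type*} {l : Filter α} [Module 𝕜 (Germ l ℂ)] (γ : E →ₗ[𝕜] Germ l ℂ) : Prop :=
  IsTopologicalAddGroup E ∧ ContinuousSMul 𝕜 E ∧ PolynormableSpace 𝕜 E ∧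
  Function.Injective γ ∧ (∃ e, γ e = 1) ∧
  ∃ mul : E →ₗ[𝕜] E →ₗ[𝕜] E,
    (∀ x y, γ (mul x y) = γ x * γ y) ∧ Continuous fun p : E × E => mul p.1 p.2

end Abstract

/-! ### Generating sets of linear poles -/

variable {k : ℕ}

/-- The vector of `ℂ^k` with the given real coordinates. -/
def ofRealVec (x : Fin k → ℝ) : Fin k → ℂ := fun i => (x i : ℂ)

/-- A generating set: a nonempty countable set of nonzero linear forms on `ℂ^k` with real
coefficients. -/
structure GeneratingSet (k : ℕ) where
  forms : Set ((Fin k → ℂ) →ₗ[ℂ] ℂ)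
  nonempty : forms.Nonempty
  countable : forms.Countable
  ne_zero : ∀ L ∈ forms, L ≠ 0
  real : ∀ L ∈ forms, ∀ x : Fin k → ℝ, (L (ofRealVec x)).im = 0

variable (𝓛 : GeneratingSet k)

/-- The semigroup (without unit) of functions on `ℂ^k` generated by a generating set under
pointwise multiplication, i.e. all products `L₁ ⋯ L_m`, `m ≥ 1`. -/
def GeneratingSet.semigroup : Subsemigroup ((Fin k → ℂ) → ℂ) :=
  Subsemigroup.closure {P | ∃ L ∈ 𝓛.forms, P = fun z => L z}

/-- The elements of the semigroup, as a type to be ordered by divisibility. -/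
def Pole : Type := {P : (Fin k → ℂ) → ℂ // P ∈ 𝓛.semigroup}

variable {𝓛} in
/-- The polynomial function of a pole. -/
def Pole.fn (P : Pole 𝓛) : (Fin k → ℂ) → ℂ := P.1

/-- `P ≼ R` if `P = R` or `R = S * P` with `S` in the semigroup. -/
instance : Preorder (Pole 𝓛) where
  le P R := P = R ∨ ∃ S : Pole 𝓛, R.fn = S.fn * P.fn
  le_refl P := Or.inl rfl
  le_trans := by
    rintro P R T (rfl | ⟨S, hS⟩) (rfl | ⟨S', hS'⟩)
    · exact Or.inl rfl
    · exact Or.inr ⟨S', hS'⟩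
    · exact Or.inr ⟨S, hS⟩
    · exact Or.inr ⟨⟨S'.fn * S.fn, 𝓛.semigroup.mul_mem S'.2 S.2⟩, by
        rw [hS', hS, ← mul_assoc]; rfl⟩

variable {𝓛}

theorem Pole.continuous (P : Pole 𝓛) : Continuous P.fn := by
  obtain ⟨P, hP⟩ := P
  refine Subsemigroup.closure_induction (p := fun P _ => Continuous P) ?_ ?_ hP
  · rintro _ ⟨L, -, rfl⟩
    exact L.continuous_of_finiteDimensional
  · intro f g _ _ hf hg
    exact hf.mul hg

theorem Pole.differentiable (P : Pole 𝓛) : Differentiable ℂ P.fn := by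
  obtain ⟨P, hP⟩ := P
  refine Subsemigroup.closure_induction (p := fun P _ => Differentiable ℂ P) ?_ ?_ hP
  · rintro _ ⟨L, -, rfl⟩
    exact L.toContinuousLinearMap.differentiable
  · intro f g _ _ hf hg
    exact hf.mul hg

theorem Pole.real (P : Pole 𝓛) (x : Fin k → ℝ) : (P.fn (ofRealVec x)).im = 0 := by
  obtain ⟨P, hP⟩ := P
  refine Subsemigroup.closure_induction (p := fun P _ => (P (ofRealVec x)).im = 0) ?_ ?_ hP
  · rintro _ ⟨L, hL, rfl⟩
    exact 𝓛.real L hL x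
  · intro f g _ _ hf hg
    simp [Complex.mul_im, hf, hg]

theorem Pole.dense (P : Pole 𝓛) : Dense {z | P.fn z ≠ 0} := by
  have key : IsOpen {z | P.fn z ≠ 0} ∧ Dense {z | P.fn z ≠ 0} := by
    obtain ⟨P, hP⟩ := P
    refine Subsemigroup.closure_induction
      (p := fun P _ => IsOpen {z | P z ≠ 0} ∧ Dense {z | P z ≠ 0}) ?_ ?_ hP
    · rintro _ ⟨L, hL, rfl⟩
      refine ⟨isOpen_ne_fun L.continuous_of_finiteDimensional continuous_const, ?_⟩
      refine (interior_eq_empty_iff_dense_compl (s := {z | L z = 0})).1 ?_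
      by_contra h
      have h' := Submodule.eq_top_of_nonempty_interior' (R := ℂ) (LinearMap.ker L)
        (Set.nonempty_iff_ne_empty.2 h)
      exact 𝓛.ne_zero L hL (LinearMap.ker_eq_top.1 h')
    · rintro f g _ _ ⟨hf, hf'⟩ ⟨hg, hg'⟩
      have : {z | (f * g) z ≠ 0} = {z | f z ≠ 0} ∩ {z | g z ≠ 0} := by
        ext z; simp
      rw [this]
      exact ⟨hf.inter hg, hf'.inter_of_isOpen_left hg' hf⟩
  exact key.2

/-! ### Balls -/

/-- Abbreviation for inner products on `ℂ^k`. -/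
abbrev IP (k : ℕ) := InnerProductSpace.Core ℂ (Fin k → ℂ)

/-- The norm `√Q(z, z)`. -/
def IP.norm (Q : IP k) (z : Fin k → ℂ) : ℝ := √(Q.inner z z).re

theorem norm_aux (F : Type) [NormedAddCommGroup F] [InnerProductSpace ℂ F]
    (e : F ≃ₗ[ℂ] (Fin k → ℂ)) :
    (Continuous fun z => ‖e.symm z‖) ∧ ∃ C : ℝ, ∀ z, ‖z‖ ≤ C * ‖e.symm z‖ := by
  have : FiniteDimensional ℂ F := e.symm.finiteDimensional
  refine ⟨(e.symm.toLinearMap.continuous_of_finiteDimensional).norm,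
    ‖e.toLinearMap.toContinuousLinearMap‖, fun z => ?_⟩
  simpa using e.toLinearMap.toContinuousLinearMap.le_opNorm (e.symm z)

theorem IP.norm_spec (Q : IP k) :
    Continuous Q.norm ∧ ∃ C : ℝ, ∀ z, ‖z‖ ≤ C * Q.norm z :=
  @norm_aux k (Fin k → ℂ) (@InnerProductSpace.Core.toNormedAddCommGroup ℂ _ _ _ _ Q)
    (@InnerProductSpace.ofCore ℂ _ _ _ _ Q.toCore) (LinearEquiv.refl ℂ _)

/-- The open ball `B_{1/n}` around `0` for the norm of `Q`. -/
def ball (Q : IP k) (n : ℕ+) : Opens (Fin k → ℂ) :=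
  ⟨{z | Q.norm z < 1 / (n : ℝ)}, isOpen_lt Q.norm_spec.1 continuous_const⟩

theorem ball_mono (Q : IP k) {n m : ℕ+} (h : n ≤ m) : ball Q m ≤ ball Q n := by
  intro z hz
  refine lt_of_lt_of_le (show Q.norm z < 1 / (m : ℝ) from hz) ?_
  exact one_div_le_one_div_of_le (by exact_mod_cast n.pos) (by exact_mod_cast h)

theorem ball_mem_nhds (Q : IP k) (n : ℕ+) : (ball Q n : Set (Fin k → ℂ)) ∈ 𝓝 0 := by
  refine (ball Q n).isOpen.mem_nhds ?_
  have h0 : Q.inner 0 0 = 0 := by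
    have := Q.smul_left (0 : Fin k → ℂ) 0 0
    simpa using this
  change √(Q.inner 0 0).re < _
  rw [h0]
  simp

theorem ball_bounded (Q : IP k) (n : ℕ+) {S : (Fin k → ℂ) → ℂ} (hS : Continuous S) :
    ∃ C, ∀ z ∈ ball Q n, ‖S z‖ ≤ C := by
  obtain ⟨C, hC⟩ := Q.norm_spec.2
  obtain ⟨D, hD⟩ := (isCompact_closedBall (0 : Fin k → ℂ)
    (|C| * (1 / (n : ℝ)))).exists_bound_of_continuousOn hS.continuousOn
  refine ⟨D, fun z hz => hD z ?_⟩
  rw [mem_closedBall_zero_iff]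
  have hz' : Q.norm z ≤ 1 / (n : ℝ) := le_of_lt hz
  have h0 : 0 ≤ Q.norm z := Real.sqrt_nonneg _
  calc ‖z‖ ≤ C * Q.norm z := hC z
    _ ≤ |C| * Q.norm z := mul_le_mul_of_nonneg_right (le_abs_self C) h0
    _ ≤ _ := mul_le_mul_of_nonneg_left hz' (abs_nonneg C)

/-! ### Bounded holomorphic functions on balls -/

/-- The space of bounded holomorphic functions `B_{1/n} → ℂ` with the supremum norm. -/
def BHolC (Q : IP k) (n : ℕ+) : Submodule ℂ (ball Q n →ᵇ ℂ) where
  carrier := {f | ∃ F : (Fin k → ℂ) → ℂ, DifferentiableOn ℂ F (ball Q n) ∧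
    ∀ z : ball Q n, f z = F z}
  zero_mem' := ⟨0, differentiableOn_const 0, fun _ => rfl⟩
  add_mem' := by
    rintro f g ⟨F, hF, hf⟩ ⟨G, hG, hg⟩
    exact ⟨F + G, hF.add hG, fun z => by simp [hf, hg]⟩
  smul_mem' := by
    rintro c f ⟨F, hF, hf⟩
    exact ⟨c • F, hF.const_smul c, fun z => by simp [hf]⟩

/-- The real subspace of the bounded holomorphic functions which are real on `B_{1/n} ∩ ℝ^k`. -/
def BHolR (Q : IP k) (n : ℕ+) : Submodule ℝ (BHolC Q n) where
  carrier := {f | ∀ x : Fin k → ℝ, ∀ hx : ofRealVec x ∈ ball Q n, (f.1 ⟨_, hx⟩).im = 0}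
  zero_mem' := by intro x hx; simp
  add_mem' := by intro f g hf hg x hx; simp [hf x hx, hg x hx]
  smul_mem' := by intro c f hf x hx; simp [hf x hx]

/-- Restriction to a smaller ball, followed by multiplication with an entire function. -/
theorem exists_restrict_mul (Q : IP k) {n m : ℕ+} (h : n ≤ m) {S : (Fin k → ℂ) → ℂ}
    (hS : Differentiable ℂ S) (f : BHolC Q n) :
    ∃ g : BHolC Q m, ∀ z : ball Q m, g.1 z = f.1 ⟨z, ball_mono Q h z.2⟩ * S z := by
  obtain ⟨C, hC⟩ := ball_bounded Q m hS.continuous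
  obtain ⟨F, hF, hf⟩ := f.2
  let g₁ : ball Q m →ᵇ ℂ :=
    f.1.compContinuous ⟨fun z => ⟨z, ball_mono Q h z.2⟩, by fun_prop⟩
  let g₂ : ball Q m →ᵇ ℂ := BoundedContinuousFunction.ofNormedAddCommGroup (fun z => S z)
    (hS.continuous.comp continuous_subtype_val) C (fun z => hC z z.2)
  refine ⟨⟨g₁ * g₂, fun z => F z * S z, ?_, fun z => ?_⟩, fun z => rfl⟩
  · exact (hF.mono (ball_mono Q h)).mul hS.differentiableOn
  · exact congrArg (· * S z) (hf ⟨z, ball_mono Q h z.2⟩)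

/-- The restriction map `BHol^ℂ(B_{1/n}) → BHol^ℂ(B_{1/m})` for `n ≤ m`. -/
def BHolC.res (Q : IP k) (n m : ℕ+) (h : n ≤ m) : BHolC Q n →ₗ[ℂ] BHolC Q m where
  toFun f := ⟨f.1.compContinuous ⟨fun z => ⟨z, ball_mono Q h z.2⟩, by fun_prop⟩, by
    obtain ⟨F, hF, hf⟩ := f.2
    exact ⟨F, hF.mono (ball_mono Q h), fun z => hf _⟩⟩
  map_add' _ _ := rfl
  map_smul' _ _ := rfl

/-- The restriction map `BHol(B_{1/n}) → BHol(B_{1/m})` for `n ≤ m`. -/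
def BHolR.res (Q : IP k) (n m : ℕ+) (h : n ≤ m) : BHolR Q n →ₗ[ℝ] BHolR Q m :=
  ((BHolC.res Q n m h).restrictScalars ℝ).restrict fun _ hf x hx => hf x (ball_mono Q h hx)

/-! ### The normed spaces `Mer_P(B_{1/n})` -/

variable (𝓛) in
/-- The index set `ℕ × 𝓢_𝓛` (with `ℕ = {1, 2, …}`) with the product order. -/
abbrev Idx : Type := ℕ+ × Pole 𝓛

/-- `f ↦ f / P`, as a function on the set of points of `B_{1/n}` where `P ≠ 0`; here
`i = (n, P)`. -/
def divBy (Q : IP k) (i : Idx 𝓛) :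
    BHolC Q i.1 →ₗ[ℂ] ({z : Fin k → ℂ // z ∈ ball Q i.1 ∧ i.2.fn z ≠ 0} → ℂ) where
  toFun f z := f.1 ⟨z, z.2.1⟩ / i.2.fn z
  map_add' f g := by ext z; simp [add_div]
  map_smul' c f := by ext z; simp [mul_div_assoc]

theorem divBy_injective (Q : IP k) (i : Idx 𝓛) : Function.Injective (divBy Q i) := by
  rw [← LinearMap.ker_eq_bot, LinearMap.ker_eq_bot']
  intro f hf
  have h0 : ∀ z : ball Q i.1, i.2.fn z ≠ 0 → f.1 z = 0 := by
    intro z hz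
    have := congrFun hf ⟨z, z.2, hz⟩
    simpa [divBy, hz] using this
  have hd : Dense {z : ball Q i.1 | i.2.fn z ≠ 0} :=
    i.2.dense.preimage (ball Q i.1).isOpen.isOpenMap_subtype_val
  have : (f.1 : ball Q i.1 → ℂ) = fun _ => 0 :=
    Continuous.ext_on hd f.1.continuous continuous_const fun z hz => h0 z hz
  ext z
  exact congrFun this z

/-- The space `Mer_P^ℂ(B_{1/n}) = {f / P | f ∈ BHol^ℂ(B_{1/n})}`, `i = (n, P)`. -/
def MerC (Q : IP k) (i : Idx 𝓛) : Type := LinearMap.range (divBy Q i)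

instance (Q : IP k) (i : Idx 𝓛) : AddCommGroup (MerC Q i) :=
  inferInstanceAs (AddCommGroup (LinearMap.range (divBy Q i)))

instance (Q : IP k) (i : Idx 𝓛) : Module ℂ (MerC Q i) :=
  inferInstanceAs (Module ℂ (LinearMap.range (divBy Q i)))

/-- The bijection `f ↦ f / P`. -/
def MerC.mk (Q : IP k) (i : Idx 𝓛) : BHolC Q i.1 ≃ₗ[ℂ] MerC Q i :=
  LinearEquiv.ofInjective (divBy Q i) (divBy_injective Q i)

/-- The norm `‖f / P‖ = ‖f‖_∞`. -/
instance (Q : IP k) (i : Idx 𝓛) : NormedAddCommGroup (MerC Q i) :=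
  NormedAddCommGroup.induced (MerC Q i) (BHolC Q i.1) (MerC.mk Q i).symm
    (MerC.mk Q i).symm.injective

instance (Q : IP k) (i : Idx 𝓛) : NormedSpace ℂ (MerC Q i) :=
  NormedSpace.induced ℂ (MerC Q i) (BHolC Q i.1) (MerC.mk Q i).symm

/-- The real subspace `Mer_P(B_{1/n})` of all `f / P` with `f` real on `B_{1/n} ∩ ℝ^k`. -/
def MerR (Q : IP k) (i : Idx 𝓛) : Submodule ℝ (MerC Q i) :=
  (BHolR Q i.1).map ((MerC.mk Q i).toLinearMap.restrictScalars ℝ)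

theorem reg_mono (Q : IP k) {i j : Idx 𝓛} (h : i ≤ j) {z : Fin k → ℂ}
    (hz : z ∈ ball Q j.1 ∧ j.2.fn z ≠ 0) : z ∈ ball Q i.1 ∧ i.2.fn z ≠ 0 := by
  refine ⟨ball_mono Q h.1 hz.1, ?_⟩
  rcases h.2 with h | ⟨S, hS⟩
  · rw [h]; exact hz.2
  · intro h0
    apply hz.2
    rw [hS, Pi.mul_apply, h0, mul_zero]

theorem exists_cofactor {P R : Pole 𝓛} (h : P ≤ R) : ∃ S : (Fin k → ℂ) → ℂ, Differentiable ℂ S ∧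
    (∀ x : Fin k → ℝ, (S (ofRealVec x)).im = 0) ∧ R.fn = S * P.fn := by
  rcases h with rfl | ⟨S, hS⟩
  · exact ⟨1, differentiable_const 1, fun x => by simp, by simp⟩
  · exact ⟨S.fn, S.differentiable, S.real, hS⟩

/-- If `f / P` lies in the smaller space, then its restriction is of the form `g / R`. -/
theorem exists_numerator (Q : IP k) {i j : Idx 𝓛} (h : i ≤ j) (f : BHolC Q i.1) :
    ∃ g : BHolC Q j.1, (f ∈ BHolR Q i.1 → g ∈ BHolR Q j.1) ∧
      ∀ z : {z : Fin k → ℂ // z ∈ ball Q j.1 ∧ j.2.fn z ≠ 0},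
        divBy Q j g z = divBy Q i f ⟨z, reg_mono Q h z.2⟩ := by
  obtain ⟨S, hS, hSr, hR⟩ := exists_cofactor h.2
  obtain ⟨g, hg⟩ := exists_restrict_mul Q h.1 hS f
  refine ⟨g, fun hf x hx => ?_, fun z => ?_⟩
  · rw [hg, Complex.mul_im, hSr, hf x (ball_mono Q h.1 hx)]
    simp
  · have hz := z.2.2
    have hi := (reg_mono Q h z.2).2
    have hR' : j.2.fn z = S z * i.2.fn z := congrFun hR z
    rw [hR'] at hz
    have hSz : S z ≠ 0 := left_ne_zero_of_mul hz
    have e : g.1 ⟨z, z.2.1⟩ = f.1 ⟨z, (reg_mono Q h z.2).1⟩ * S z := hg ⟨z, z.2.1⟩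
    calc g.1 ⟨z, z.2.1⟩ / j.2.fn z
        = (f.1 ⟨z, (reg_mono Q h z.2).1⟩ * S z) / (S z * i.2.fn z) := congrArg₂ _ e hR'
      _ = f.1 ⟨z, (reg_mono Q h z.2).1⟩ / i.2.fn z := by field_simp

/-- The inclusion `Mer_P^ℂ(B_{1/n}) → Mer_R^ℂ(B_{1/m})` for `(n, P) ≤ (m, R)`, given by restriction
of functions. -/
def MerC.res (Q : IP k) (i j : Idx 𝓛) (h : i ≤ j) : MerC Q i →ₗ[ℂ] MerC Q j where
  toFun u := ⟨fun z => u.1 ⟨z, reg_mono Q h z.2⟩, by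
    obtain ⟨f, hf⟩ := u.2
    obtain ⟨g, -, hg⟩ := exists_numerator Q h f
    exact ⟨g, by ext z; rw [hg, hf]⟩⟩
  map_add' _ _ := rfl
  map_smul' _ _ := rfl

/-- The inclusion `Mer_P(B_{1/n}) → Mer_R(B_{1/m})` for `(n, P) ≤ (m, R)`. -/
def MerR.res (Q : IP k) (i j : Idx 𝓛) (h : i ≤ j) : MerR Q i →ₗ[ℝ] MerR Q j :=
  ((MerC.res Q i j h).restrictScalars ℝ).restrict <| by
    rintro _ ⟨f, hf, rfl⟩
    obtain ⟨g, hgr, hg⟩ := exists_numerator Q h f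
    exact ⟨g, hgr hf, Subtype.ext (funext hg)⟩

/-! ### The inductive limits -/

/-- The locally convex inductive limit of the spaces `Mer_P^ℂ(B_{1/n})`, a complex space. -/
abbrev MeroC (Q : IP k) (𝓛 : GeneratingSet k) : Type :=
  LCLim ℂ (fun i : Idx 𝓛 => MerC Q i) (MerC.res Q)

/-- The locally convex inductive limit of the spaces `Mer_P(B_{1/n})`, a real space. -/
abbrev MeroR (Q : IP k) (𝓛 : GeneratingSet k) : Type :=
  LCLim ℝ (fun i : Idx 𝓛 => MerR Q i) (MerR.res Q)

/-- The locally convex inductive limit of the spaces `BHol^ℂ(B_{1/n})`, a complex space. -/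
abbrev HoloC (Q : IP k) : Type := LCLim ℂ (fun n : ℕ+ => BHolC Q n) (BHolC.res Q)

/-- The locally convex inductive limit of the spaces `BHol(B_{1/n})`, a real space. -/
abbrev HoloR (Q : IP k) : Type := LCLim ℝ (fun n : ℕ+ => BHolR Q n) (BHolR.res Q)

/-- The canonical map `BHol^ℂ(B_{1/n}) → H^ℂ(ℂ^k)`. -/
def HoloC.of (Q : IP k) (n : ℕ+) : BHolC Q n →ₗ[ℂ] HoloC Q :=
  LCLim.of ℂ (fun n : ℕ+ => BHolC Q n) (BHolC.res Q) n

/-- The canonical map `BHol(B_{1/n}) → H(ℂ^k)`. -/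
def HoloR.of (Q : IP k) (n : ℕ+) : BHolR Q n →ₗ[ℝ] HoloR Q :=
  LCLim.of ℝ (fun n : ℕ+ => BHolR Q n) (BHolR.res Q) n

/-! ### Germs -/

variable (𝓛) in
/-- The filter on `ℂ^k` generated by the sets `U \ {P = 0}` with `U` a neighbourhood of `0` and `P`
in the semigroup. Germs along this filter are germs at `0` of functions defined off the zero set
of some `P`. -/
def poleFilter : Filter (Fin k → ℂ) := 𝓝 0 ⊓ ⨅ P : Pole 𝓛, 𝓟 {z | P.fn z ≠ 0}

theorem reg_mem (Q : IP k) (i : Idx 𝓛) :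
    {z | z ∈ ball Q i.1 ∧ i.2.fn z ≠ 0} ∈ poleFilter 𝓛 :=
  inter_mem_inf (ball_mem_nhds Q i.1) (mem_iInf_of_mem i.2 (mem_principal_self _))

/-- The germ of `f / P`. -/
def MerC.germ (Q : IP k) (i : Idx 𝓛) : MerC Q i →ₗ[ℂ] Germ (poleFilter 𝓛) ℂ where
  toFun u := ((Function.extend Subtype.val u.1 0 : (Fin k → ℂ) → ℂ) : Germ (poleFilter 𝓛) ℂ)
  map_add' u v := by
    rw [← Germ.coe_add]
    refine congrArg _ ?_
    have := Function.extend_add Subtype.val u.1 v.1 (0 : (Fin k → ℂ) → ℂ) 0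
    rw [add_zero] at this
    exact this
  map_smul' c u := by
    rw [RingHom.id_apply, ← Germ.coe_smul]
    refine congrArg _ ?_
    have := Function.extend_smul c Subtype.val u.1 (0 : (Fin k → ℂ) → ℂ)
    rw [smul_zero] at this
    exact this

theorem MerC.germ_res (Q : IP k) (i j : Idx 𝓛) (h : i ≤ j) (u : MerC Q i) :
    MerC.germ Q j (MerC.res Q i j h u) = MerC.germ Q i u := by
  refine Germ.coe_eq.2 ?_
  filter_upwards [reg_mem Q j] with z hz
  rw [Subtype.val_injective.extend_apply (MerC.res Q i j h u).1 0 ⟨z, hz⟩,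
    Subtype.val_injective.extend_apply u.1 0 ⟨z, reg_mono Q h hz⟩]
  rfl

/-- The germ of an element of the limit of the `Mer_P^ℂ(B_{1/n})`. -/
def MeroC.germ (Q : IP k) (𝓛 : GeneratingSet k) : MeroC Q 𝓛 →ₗ[ℂ] Germ (poleFilter 𝓛) ℂ :=
  LCLim.lift ℂ _ _ (MerC.germ Q) (MerC.germ_res Q)

/-- The germ of an element of the limit of the `Mer_P(B_{1/n})`. -/
def MeroR.germ (Q : IP k) (𝓛 : GeneratingSet k) : MeroR Q 𝓛 →ₗ[ℝ] Germ (poleFilter 𝓛) ℂ :=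
  LCLim.lift ℝ _ _ (fun i => ((MerC.germ Q i).restrictScalars ℝ).comp (MerR Q i).subtype)
    (fun i j h u => MerC.germ_res Q i j h u.1)

/-- The germ along `poleFilter 𝓛` of a bounded holomorphic function on a ball. -/
def BHolC.germ (Q : IP k) (𝓛 : GeneratingSet k) (n : ℕ+) (f : BHolC Q n) :
    Germ (poleFilter 𝓛) ℂ :=
  ((Function.extend Subtype.val f.1 0 : (Fin k → ℂ) → ℂ) : Germ (poleFilter 𝓛) ℂ)

end SilvaGerms

end

open SilvaGerms

/-!
Everything rests on two abstract facts about a locally convex space `E` that is the union of an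
increasing sequence of Banach spaces `Y n` with compact inclusions, and on two facts from complex
analysis.

*Silva spaces are Hausdorff and complete.* A seminorm on `E` is continuous as soon as it is so on
every step, so all neighbourhoods are produced by constructing seminorms; `exists_seminorm_inf`
(infimum along the fibres of a surjection) is the tool. For `x ≠ 0`, radii `ε n > 0` are chosen one
after the other such that the compact sets `∑ j < n, ε j • closure (unit ball of Y j)` never contain
`x`. This only needs that a point outside a compact set has positive distance from it, and it
yields a continuous seminorm that does not vanish at `x` (`IsSilva.t2Space`). For completeness
(`IsSilva.isCompleteTVS`), a Cauchy filter meets every neighbourhood of a suitable multiple of the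
unit ball of some step. Otherwise each ball `B n` has a neighbourhood `B n + U n` which is
eventually avoided by the filter, and `⋂ n, (B n + U n)` is a neighbourhood of `0` which
contradicts the Cauchy property. The ball is relatively compact in the next step, which gives a
cluster point.

*Multiplication is jointly continuous* (`exists_seminorm_mul_le`). If `q (x * y) ≤ C n m * ‖x‖ * ‖y‖`
for `x ∈ Y n`, `y ∈ Y m`, then weights `w` with `C n m ≤ w n * w m` exist because there are only
countably many steps. The largest seminorm `p` with `p ≤ w n * ‖·‖` on every `Y n` then satisfies
`q (x * y) ≤ p x * p y`, by maximality applied to one variable at a time.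

*Complex analysis.* The Schwarz lemma bounds the oscillation of a bounded holomorphic function.
Together with the Arzelà–Ascoli theorem this makes the restriction to a strictly smaller ball
compact (`BHolC.isCompactOperator_res`), and it also gives that uniform limits are holomorphic, so
that the steps are Banach spaces. The identity theorem (`BHolC.eq_zero_of_eventually`), in the form
in which it follows from the one-variable theorem on complex lines through `0`, shows that a
function on a ball is determined by its germ off the zeros of a pole.

Since the generating set is countable, so is the semigroup of poles, and the initial products
of an enumeration of the poles give a cofinal sequence of steps with compact inclusions
(`exists_cofinal_seq`). The real spaces are closed real subspaces of the complex ones and inherit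
all of this. Holomorphic germs embed by `f ↦ (f * P) / P` for an arbitrary pole `P`.
-/

noncomputable section

namespace SilvaGerms

/-! ### Seminorms and final locally convex topologies -/

section Final

universe u v w

variable {𝕜 : Type w} [RCLike 𝕜] {E : Type*} [AddCommGroup E] [Module 𝕜 E]

/-- The infimum of a seminorm along the fibres of a surjective linear map is a seminorm. -/
theorem exists_seminorm_inf {F : Type*} [AddCommGroup F] [Module 𝕜 F] (Φ : F →ₗ[𝕜] E)
    (hΦ : Function.Surjective Φ) (N : Seminorm 𝕜 F) :
    ∃ p : Seminorm 𝕜 E, (∀ y, p (Φ y) ≤ N y) ∧ ∀ x r, p x < r → ∃ y, Φ y = x ∧ N y < r := by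
  have hne : ∀ x, Nonempty {y // Φ y = x} := fun x => (hΦ x).elim fun y hy => ⟨⟨y, hy⟩⟩
  have hbdd : ∀ x, BddBelow (Set.range fun y : {y // Φ y = x} => N y.1) := fun x =>
    ⟨0, by rintro _ ⟨y, rfl⟩; exact apply_nonneg N _⟩
  let q : E → ℝ := fun x => ⨅ y : {y // Φ y = x}, N y.1
  have hle : ∀ y, q (Φ y) ≤ N y := fun y => ciInf_le (hbdd (Φ y)) ⟨y, rfl⟩
  have hlt : ∀ x r, q x < r → ∃ y, Φ y = x ∧ N y < r := fun x r h => by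
    obtain ⟨⟨y, hy⟩, hr⟩ := exists_lt_of_ciInf_lt h
    exact ⟨y, hy, hr⟩
  refine ⟨Seminorm.ofSMulLE q (le_antisymm ?_ ?_) ?_ ?_, hle, hlt⟩
  · simpa using hle 0
  · exact Real.iInf_nonneg fun _ => apply_nonneg N _
  · intro x y
    refine le_of_forall_pos_lt_add fun ε hε => ?_
    obtain ⟨a, rfl, ha⟩ := hlt x (q x + ε / 2) (by linarith)
    obtain ⟨b, rfl, hb⟩ := hlt y (q y + ε / 2) (by linarith)
    have h1 := hle (a + b)
    rw [map_add] at h1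
    have h2 := map_add_le_add N a b
    linarith
  · intro c x
    refine le_of_forall_pos_lt_add fun ε hε => ?_
    obtain ⟨a, rfl, ha⟩ := hlt x (q x + ε / (‖c‖ + 1)) (by
      have : 0 < ε / (‖c‖ + 1) := by positivity
      linarith)
    have h1 := hle (c • a)
    rw [map_smul, map_smul_eq_mul] at h1
    have h3 : ‖c‖ * (ε / (‖c‖ + 1)) < ε := by
      rw [mul_div_assoc', div_lt_iff₀ (by positivity)]
      nlinarith [norm_nonneg c]
    nlinarith [norm_nonneg c, mul_le_mul_of_nonneg_left ha.le (norm_nonneg c)]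

variable {ι : Type v} {X : ι → Type u}

section TopSteps

variable [∀ i, AddCommGroup (X i)] [∀ i, Module 𝕜 (X i)] [∀ i, TopologicalSpace (X i)]
  {f : ∀ i, X i →ₗ[𝕜] E} [t : TopologicalSpace E]

theorem lcFinal.withSeminorms (ht : t = lcFinal 𝕜 f) : WithSeminorms
    (fun p : {p : Seminorm 𝕜 E // ∀ i, Continuous fun x => p (f i x)} => p.1) := ⟨ht⟩

theorem lcFinal.continuous_seminorm (ht : t = lcFinal 𝕜 f) (p : Seminorm 𝕜 E)
    (hp : ∀ i, Continuous fun x => p (f i x)) : Continuous p :=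
  (lcFinal.withSeminorms ht).continuous_seminorm ⟨p, hp⟩

theorem lcFinal.continuous_step [∀ i, IsTopologicalAddGroup (X i)] (ht : t = lcFinal 𝕜 f) (i : ι) :
    Continuous (f i) :=
  (lcFinal.withSeminorms ht).continuous_of_continuous_comp (f i) fun p => p.2 i

/-- A linear map out of a final locally convex space is continuous as soon as it is so on the
steps. -/
theorem lcFinal.continuous_linearMap (ht : t = lcFinal 𝕜 f) {G : Type*} [AddCommGroup G]
    [Module 𝕜 G] [TopologicalSpace G] {κ : Type*} {q : SeminormFamily 𝕜 G κ}
    (hq : WithSeminorms q) (T : E →ₗ[𝕜] G)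
    (hT : ∀ i, Continuous fun x => T (f i x)) : Continuous T := by
  have := (lcFinal.withSeminorms ht).topologicalAddGroup
  refine hq.continuous_of_continuous_comp T fun j => ?_
  exact lcFinal.continuous_seminorm ht _ fun i => (hq.continuous_seminorm j).comp (hT i)

theorem lcFinal.exists_seminorm_of_mem_nhds (ht : t = lcFinal 𝕜 f) {V : Set E} (hV : V ∈ 𝓝 0) :
    ∃ p : Seminorm 𝕜 E, Continuous p ∧ ∀ x, p x < 1 → x ∈ V := by
  have hp := lcFinal.withSeminorms ht
  have := hp.topologicalAddGroup
  have := hp.continuousSMul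
  obtain ⟨s, r, hr, hs⟩ := (hp.mem_nhds_iff 0 V).1 hV
  let P : Seminorm 𝕜 E := s.sup fun p => p.1
  have hP : Continuous P := Seminorm.continuous_finsetSup fun i _ => hp.continuous_seminorm i
  refine ⟨NNReal.mk r⁻¹ (by positivity) • P, hP.const_smul (NNReal.mk r⁻¹ (by positivity)),
    fun x hx => hs ?_⟩
  rw [Seminorm.mem_ball_zero]
  have h1 : r⁻¹ * P x < 1 := hx
  rwa [inv_mul_lt_iff₀ hr, mul_one] at h1

end TopSteps

/-- Two families of linear maps which make the same seminorms continuous have the same final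
locally convex topology. -/
theorem lcFinal_congr {κ : Type*} {Z : κ → Type*}
    [∀ i, AddCommGroup (X i)] [∀ i, Module 𝕜 (X i)] [∀ i, TopologicalSpace (X i)]
    [∀ i, AddCommGroup (Z i)] [∀ i, Module 𝕜 (Z i)] [∀ i, TopologicalSpace (Z i)]
    {f : ∀ i, X i →ₗ[𝕜] E} {g : ∀ i, Z i →ₗ[𝕜] E}
    (h : ∀ p : Seminorm 𝕜 E,
      (∀ i, Continuous fun x => p (f i x)) ↔ ∀ i, Continuous fun x => p (g i x)) :
    lcFinal 𝕜 f = lcFinal 𝕜 g := by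
  let top (S : Seminorm 𝕜 E → Prop) : TopologicalSpace E :=
    (SeminormFamily.moduleFilterBasis (𝕜 := 𝕜) (F := E) (ι := {p : Seminorm 𝕜 E // S p})
      (fun p => p.1)).topology
  change top _ = top _
  exact congrArg top (funext fun p => propext (h p))

theorem continuous_seminorm_of_bound {Y : Type*} [NormedAddCommGroup Y] [NormedSpace 𝕜 Y]
    (p : Seminorm 𝕜 Y) (C : ℝ) (h : ∀ y, p y ≤ C * ‖y‖) : Continuous p := by
  refine Seminorm.continuous_of_le (q := NNReal.mk |C| (abs_nonneg C) • normSeminorm 𝕜 Y)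
    (continuous_norm.const_smul (NNReal.mk |C| (abs_nonneg C))) fun y => (h y).trans ?_
  exact mul_le_mul_of_nonneg_right (le_abs_self C) (norm_nonneg y)

end Final

section Sequence

universe u v w

variable {𝕜 : Type w} [RCLike 𝕜] {E : Type v} [AddCommGroup E] [Module 𝕜 E]
  {Y : ℕ → Type u} [∀ n, NormedAddCommGroup (Y n)] [∀ n, NormedSpace 𝕜 (Y n)]
  {f : ∀ n, Y n →ₗ[𝕜] E}

/-- The largest seminorm on `E` which is at most `w n` times the norm on the `n`-th step. -/
theorem exists_largest_seminorm (hsurj : ∀ x, ∃ n y, f n y = x) (w : ℕ → ℝ) :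
    ∃ p : Seminorm 𝕜 E, (∀ n y, p (f n y) ≤ |w n| * ‖y‖) ∧
      ∀ s : Seminorm 𝕜 E, (∀ n y, s (f n y) ≤ |w n| * ‖y‖) → ∀ x, s x ≤ p x := by
  let A : Set (Seminorm 𝕜 E) := {s | ∀ n y, s (f n y) ≤ |w n| * ‖y‖}
  have hA : BddAbove A := by
    rw [Seminorm.bddAbove_iff]
    choose n y hy using hsurj
    refine ⟨fun x => |w (n x)| * ‖y x‖, ?_⟩
    rintro _ ⟨s, hs, rfl⟩ x
    conv_lhs => rw [← hy x]
    exact hs _ _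
  refine ⟨sSup A, fun n y => ?_, fun s hs x => le_csSup hA hs x⟩
  rw [Seminorm.sSup_apply hA]
  exact Real.iSup_le (fun s => s.2 n y) (by positivity)

/-- On a countable inductive limit of normed spaces, a bilinear map which is bounded on all pairs
of steps is jointly controlled by a single seminorm. -/
theorem exists_seminorm_mul_le (hsurj : ∀ x, ∃ n y, f n y = x) (mul : E →ₗ[𝕜] E →ₗ[𝕜] E)
    (q : Seminorm 𝕜 E)
    (h : ∀ n m, ∃ C, ∀ x y, q (mul (f n x) (f m y)) ≤ C * (‖x‖ * ‖y‖)) :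
    ∃ p : Seminorm 𝕜 E, (∀ n, Continuous fun y => p (f n y)) ∧
      ∀ x y, q (mul x y) ≤ p x * p y := by
  choose C hC using h
  -- The weights dominate all constants that involve an earlier or the current step.
  let w : ℕ → ℝ := fun n =>
    1 + ∑ i ∈ Finset.range (n + 1), ∑ j ∈ Finset.range (n + 1), |C i j|
  have hw1 : ∀ n, 1 ≤ w n := fun n => le_add_of_nonneg_right (by positivity)
  have hCw : ∀ N n m, n ≤ N → m ≤ N → |C n m| ≤ w N := fun N n m hn hm => by
    have h1 : |C n m| ≤ ∑ j ∈ Finset.range (N + 1), |C n j| :=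
      Finset.single_le_sum (f := fun j => |C n j|) (fun _ _ => abs_nonneg _) (by simp; omega)
    have h2 : ∑ j ∈ Finset.range (N + 1), |C n j| ≤
        ∑ i ∈ Finset.range (N + 1), ∑ j ∈ Finset.range (N + 1), |C i j| :=
      Finset.single_le_sum (f := fun i => ∑ j ∈ Finset.range (N + 1), |C i j|)
        (fun _ _ => by positivity) (by simp; omega)
    change _ ≤ 1 + _
    linarith
  have habs : ∀ n, |w n| = w n := fun n => abs_of_nonneg (by linarith [hw1 n])
  have hCww : ∀ n m, |C n m| ≤ w n * w m := fun n m => by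
    rcases le_total n m with hnm | hnm
    · nlinarith [hCw m n m hnm le_rfl, hw1 n, hw1 m]
    · nlinarith [hCw n n m le_rfl hnm, hw1 n, hw1 m]
  have hq : ∀ n m x y, q (mul (f n x) (f m y)) ≤ (w n * ‖x‖) * (w m * ‖y‖) := fun n m x y =>
    calc q (mul (f n x) (f m y)) ≤ C n m * (‖x‖ * ‖y‖) := hC n m x y
      _ ≤ (w n * w m) * (‖x‖ * ‖y‖) :=
        mul_le_mul_of_nonneg_right ((le_abs_self _).trans (hCww n m)) (by positivity)
      _ = _ := by ring
  obtain ⟨p, hp, hmax⟩ := exists_largest_seminorm (𝕜 := 𝕜) hsurj w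
  simp only [habs] at hp hmax
  -- The maximality of `p` is applied to each variable in turn.
  have aux : ∀ (s : Seminorm 𝕜 E) (a : ℝ), 0 ≤ a → (∀ n y, s (f n y) ≤ a * (w n * ‖y‖)) →
      ∀ x, s x ≤ a * p x := by
    intro s a ha hs x
    refine le_of_forall_pos_lt_add fun ε hε => ?_
    obtain ⟨δ, hδ, hδε⟩ : ∃ δ > 0, δ * p x < ε := by
      refine ⟨ε / (p x + 1), by have := apply_nonneg p x; positivity, ?_⟩
      rw [div_mul_eq_mul_div, div_lt_iff₀ (by have := apply_nonneg p x; positivity)]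
      nlinarith [apply_nonneg p x]
    have hpos : 0 < a + δ := by linarith
    have := hmax (NNReal.mk (a + δ)⁻¹ (by positivity) • s) (fun n y => by
      change (a + δ)⁻¹ * s (f n y) ≤ _
      rw [inv_mul_le_iff₀ hpos]
      refine (hs n y).trans (mul_le_mul_of_nonneg_right (by linarith) ?_)
      have := hw1 n
      positivity) x
    change (a + δ)⁻¹ * s x ≤ _ at this
    rw [inv_mul_le_iff₀ hpos] at this
    linarith
  refine ⟨p, fun n => continuous_seminorm_of_bound (p.comp (f n)) (w n) (hp n), fun x y => ?_⟩
  have h1 : ∀ m y x, q (mul x (f m y)) ≤ (w m * ‖y‖) * p x := fun m y x =>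
    aux (q.comp (mul.flip (f m y))) (w m * ‖y‖) (by have := hw1 m; positivity)
      (fun n x => (hq n m x y).trans_eq (mul_comm _ _)) x
  exact aux (q.comp (mul x)) (p x) (apply_nonneg p x)
    (fun m y => (h1 m y x).trans_eq (mul_comm _ _)) y

end Sequence

/-! ### Silva spaces are Hausdorff and complete -/

section Silva

universe u v w

section

variable {𝕜 : Type w} [RCLike 𝕜] {E : Type v} [AddCommGroup E] [Module 𝕜 E]
  {Y : ℕ → Type u} [∀ n, NormedAddCommGroup (Y n)] [∀ n, NormedSpace 𝕜 (Y n)]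
  {f : ∀ n, Y n →ₗ[𝕜] E}

/-- A weighted `ℓ¹` seminorm on a sequential inductive limit: vectors of seminorm less than `1` are
finite sums of small vectors of the steps. -/
theorem exists_weighted_seminorm (hsurj : ∀ x, ∃ n y, f n y = x) (w : ℕ → ℝ)
    (hw : ∀ n, 0 ≤ w n) :
    ∃ p : Seminorm 𝕜 E, (∀ n y, p (f n y) ≤ w n * ‖y‖) ∧
      ∀ x, p x < 1 → ∃ (M : ℕ) (y : ∀ n, Y n), x = ∑ j ∈ Finset.range M, f j (y j) ∧
        ∀ j, w j * ‖y j‖ < 1 := by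
  classical
  let Φ : (Π₀ n, Y n) →ₗ[𝕜] E := DFinsupp.lsum ℕ f
  have hsum : ∀ y : Π₀ n, Y n, ∃ M, Φ y = ∑ j ∈ Finset.range M, f j (y j) := by
    intro y
    obtain ⟨M, hM⟩ := y.support.exists_nat_subset_range
    refine ⟨M, ?_⟩
    change DFinsupp.sumAddHom (fun i => (f i).toAddMonoidHom) y = _
    rw [DFinsupp.sumAddHom_apply, DFinsupp.sum]
    refine Finset.sum_subset hM fun j _ hj => ?_
    rw [DFinsupp.notMem_support_iff.1 hj]
    exact map_zero _
  have hfin : ∀ y : Π₀ n, Y n, Summable fun n => w n * ‖y n‖ := fun y =>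
    summable_of_hasFiniteSupport <| y.support.finite_toSet.subset fun n hn =>
      DFinsupp.mem_support_iff.2 fun h => hn (by simp [h])
  let N : Seminorm 𝕜 (Π₀ n, Y n) := Seminorm.of (fun y => ∑' n, w n * ‖y n‖)
    (fun x y => by
      rw [← (hfin x).tsum_add (hfin y)]
      refine (hfin _).tsum_le_tsum (fun n => ?_) ((hfin x).add (hfin y))
      rw [← mul_add]
      exact mul_le_mul_of_nonneg_left (norm_add_le _ _) (hw n))
    (fun c x => by
      rw [← tsum_mul_left]
      refine tsum_congr fun n => ?_
      rw [DFinsupp.smul_apply, norm_smul]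
      ring)
  have hΦsingle : ∀ n y, Φ (DFinsupp.single n y) = f n y := fun n y =>
    DFinsupp.lsum_single ℕ f n y
  obtain ⟨p, hp, hp'⟩ := exists_seminorm_inf Φ
    (fun x => by obtain ⟨n, y, rfl⟩ := hsurj x; exact ⟨_, hΦsingle n y⟩) N
  refine ⟨p, fun n y => ?_, fun x hx => ?_⟩
  · have h1 := hp (DFinsupp.single n y)
    rw [hΦsingle] at h1
    refine h1.trans_eq ?_
    change ∑' m, w m * ‖(DFinsupp.single n y : Π₀ n, Y n) m‖ = _
    rw [tsum_eq_single n fun m hm => by rw [DFinsupp.single_eq_of_ne hm]; simp,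
      DFinsupp.single_eq_same]
  · obtain ⟨y, rfl, hy⟩ := hp' x 1 hx
    obtain ⟨M, hM⟩ := hsum y
    refine ⟨M, fun n => y n, hM, fun j => lt_of_le_of_lt ?_ hy⟩
    exact (hfin y).le_tsum j fun i _ => mul_nonneg (hw i) (norm_nonneg _)

end

/-- A Silva space is Hausdorff. Given `x ≠ 0`, radii `ε j` are chosen recursively such that the
compact sets `∑ j < n, ε j • D j`, with `D j` the closure of the unit ball of the `j`-th step in the
next one, avoid `x`; the corresponding weighted seminorm does not vanish at `x`. -/
theorem IsSilva.t2Space {𝕜 : Type w} [RCLike 𝕜] {E : Type u} [AddCommGroup E] [Module 𝕜 E]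
    [t : TopologicalSpace E] (h : IsSilva 𝕜 E) : T2Space E := by
  obtain ⟨Y, _, _, _, c, f, hc, hinj, hcf, hsurj, ht⟩ := h
  have hws := lcFinal.withSeminorms ht
  have := hws.topologicalAddGroup
  suffices T1Space E from inferInstance
  refine hws.T1_of_separating fun x hx => ?_
  let D : ∀ n, Set (Y (n + 1)) := fun n => closure (c n '' Metric.closedBall 0 1)
  have hD : ∀ n, IsCompact (D n) := fun n =>
    (isCompactOperator_iff_isCompact_closure_image_closedBall (c n : Y n →ₗ[𝕜] Y (n + 1))
      one_pos).1 (hc n)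
  let S : ∀ n, Set (Y n) → Prop := fun n T => IsCompact T ∧ ∀ y ∈ T, f n y ≠ x
  let next : ∀ n, Set (Y n) → ℝ → Set (Y (n + 1)) := fun n T ε =>
    (fun z : Y (n + 1) × Y (n + 1) => z.1 + (ε : 𝕜) • z.2) '' ((c n '' T) ×ˢ D n)
  have step : ∀ n (T : {T // S n T}), ∃ ε : ℝ, 0 < ε ∧ S (n + 1) (next n T.1 ε) := by
    rintro n ⟨T, hT, hxT⟩
    have hcomp : ∀ ε : ℝ, IsCompact (next n T ε) := fun ε =>
      ((hT.image (c n).continuous).prod (hD n)).image (by fun_prop)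
    by_cases hxr : ∃ x', f (n + 1) x' = x
    · obtain ⟨x', hx'⟩ := hxr
      have hcl : IsClosed (c n '' T) := (hT.image (c n).continuous).isClosed
      have hnot : x' ∈ (c n '' T)ᶜ := by
        rintro ⟨y, hy, rfl⟩
        exact hxT y hy (by rw [← hcf, hx'])
      obtain ⟨δ, hδ, hball⟩ := Metric.isOpen_iff.1 hcl.isOpen_compl x' hnot
      obtain ⟨R, hR⟩ := (hD n).isBounded.exists_norm_le
      have hR' : 0 < |R| + 1 := by positivity
      refine ⟨δ / (|R| + 1), by positivity, hcomp _, ?_⟩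
      rintro _ ⟨⟨a, b⟩, ⟨ha, hb⟩, rfl⟩ hab
      have e : a + ((δ / (|R| + 1) : ℝ) : 𝕜) • b = x' := hinj (n + 1) (by rw [hx']; exact hab)
      refine hball ?_ ha
      rw [Metric.mem_ball, dist_eq_norm, ← e, sub_add_cancel_left, norm_neg, norm_smul,
        RCLike.norm_ofReal, abs_of_pos (by positivity), div_mul_eq_mul_div, div_lt_iff₀ hR']
      have := (hR b hb).trans (le_abs_self R)
      nlinarith
    · exact ⟨1, one_pos, hcomp _, fun y _ hy => hxr ⟨y, hy⟩⟩
  choose ε hε hS using step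
  let T : ∀ n, {T // S n T} := fun n => Nat.rec
    ⟨{0}, isCompact_singleton, by rintro y rfl; simpa using hx.symm⟩
    (fun n T => ⟨next n T.1 (ε n T), hS n T⟩) n
  have hT : ∀ n, (T (n + 1)).1 = next n (T n).1 (ε n (T n)) := fun n => rfl
  obtain ⟨p, hp, hp'⟩ := exists_weighted_seminorm (𝕜 := 𝕜) hsurj (fun n => (ε n (T n))⁻¹)
    fun n => (inv_pos.2 (hε n _)).le
  refine ⟨⟨p, fun n => continuous_seminorm_of_bound (p.comp (f n)) _ (hp n)⟩, fun h0 => ?_⟩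
  obtain ⟨M, y, hy, hyw⟩ := hp' x (by rw [show p x = 0 from h0]; exact one_pos)
  have key : ∀ n, ∃ z ∈ (T n).1, f n z = ∑ j ∈ Finset.range n, f j (y j) := by
    intro n
    induction n with
    | zero => exact ⟨0, rfl, by simp⟩
    | succ n ih =>
      obtain ⟨z, hz, hzf⟩ := ih
      have hεn := hε n (T n)
      have hne : ((ε n (T n) : ℝ) : 𝕜) ≠ 0 := by exact_mod_cast hεn.ne'
      refine ⟨c n z + c n (y n), ?_, ?_⟩
      · rw [hT]
        refine ⟨(c n z, ((ε n (T n) : ℝ) : 𝕜)⁻¹ • c n (y n)), ⟨⟨z, hz, rfl⟩, ?_⟩, ?_⟩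
        · refine subset_closure ⟨((ε n (T n) : ℝ) : 𝕜)⁻¹ • y n, ?_, by simp⟩
          rw [mem_closedBall_zero_iff, norm_smul, norm_inv, RCLike.norm_ofReal, abs_of_pos hεn]
          exact (hyw n).le
        · simp [smul_inv_smul₀ hne]
      · rw [map_add, hcf, hcf, Finset.sum_range_succ, hzf]
  obtain ⟨z, hz, hzf⟩ := key M
  exact (T M).2.2 z hz (hzf.trans hy.symm)

/-- A Silva space is complete: a Cauchy filter meets arbitrarily small neighbourhoods of a bounded
subset of some step, which is relatively compact in the next step. -/
theorem IsSilva.isCompleteTVS {𝕜 : Type w} [RCLike 𝕜] {E : Type u} [AddCommGroup E] [Module 𝕜 E]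
    [t : TopologicalSpace E] [IsTopologicalAddGroup E] (h : IsSilva 𝕜 E) : IsCompleteTVS E := by
  obtain ⟨Y, _, _, _, c, f, hc, hinj, hcf, hsurj, ht⟩ := h
  have hws := lcFinal.withSeminorms ht
  have := hws.continuousSMul
  -- The norms are rescaled by `a n` to make the linking maps contractive.
  let a : ℕ → ℝ := fun n => Nat.rec 1 (fun n r => r / (1 + ‖c n‖)) n
  have ha1 : ∀ n, a (n + 1) = a n / (1 + ‖c n‖) := fun n => rfl
  have ha : ∀ n, 0 < a n := fun n => by
    induction n with
    | zero => exact one_pos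
    | succ n ih => rw [ha1]; positivity
  have hac : ∀ n y, a (n + 1) * ‖c n y‖ ≤ a n * ‖y‖ := fun n y => by
    rw [ha1, div_mul_eq_mul_div, div_le_iff₀ (by positivity), mul_assoc]
    refine mul_le_mul_of_nonneg_left (((c n).le_opNorm y).trans ?_) (ha n).le
    nlinarith [norm_nonneg y, norm_nonneg (c n)]
  have hlink : ∀ m n, m ≤ n → ∀ y : Y m, ∃ y' : Y n, f n y' = f m y ∧ a n * ‖y'‖ ≤ a m * ‖y‖ := by
    intro m n hmn
    induction n, hmn using Nat.le_induction with
    | base => exact fun y => ⟨y, rfl, le_rfl⟩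
    | succ n hmn ih =>
      intro y
      obtain ⟨y', h1, h2⟩ := ih y
      exact ⟨c n y', by rw [hcf, h1], (hac n y').trans h2⟩
  let := IsTopologicalAddGroup.rightUniformSpace E
  have : IsUniformAddGroup E := isUniformAddGroup_of_addCommGroup
  refine ⟨fun {F} hF => ?_⟩
  have hFne : F.NeBot := hF.1
  have hcauchy : ∀ s : Seminorm 𝕜 E, Continuous s → ∀ ε > 0, ∃ A ∈ F, ∀ x ∈ A, ∀ y ∈ A,
      s (y - x) < ε := by
    intro s hs ε hε
    have h0 : {x | s x < ε} ∈ 𝓝 (0 : E) :=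
      (isOpen_lt hs continuous_const).mem_nhds (by simpa using hε)
    have h1 : {z : E × E | s (z.2 - z.1) < ε} ∈ uniformity E := by
      rw [uniformity_eq_comap_nhds_zero]
      exact preimage_mem_comap h0
    obtain ⟨A, hA, hAs⟩ := (cauchy_iff.1 hF).2 _ h1
    exact ⟨A, hA, fun x hx y hy => hAs (Set.mk_mem_prod hx hy)⟩
  -- `F` meets all neighbourhoods of a fixed multiple of the unit ball of some step.
  have hmeet : ∃ (n : ℕ) (R : ℝ), ∀ A ∈ F, ∀ s : Seminorm 𝕜 E, Continuous s →
      ∃ x ∈ A, ∃ u, s u < 1 ∧ ∃ y : Y n, ‖y‖ ≤ R ∧ f n y = x - u := by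
    by_contra! hcon
    choose A hA s hs hAs using fun n : ℕ => hcon n ((n + 1) / a n)
    let N : ∀ n, Seminorm 𝕜 (Y n × E) := fun n =>
      NNReal.mk (a n) (ha n).le • (normSeminorm 𝕜 (Y n)).comp (LinearMap.fst 𝕜 (Y n) E) +
        (s n).comp (LinearMap.snd 𝕜 (Y n) E)
    have hN : ∀ n y z, N n (y, z) = a n * ‖y‖ + s n z := fun n y z => rfl
    choose r hr hr' using fun n => exists_seminorm_inf ((f n).coprod LinearMap.id)
      (fun x => ⟨(0, x), by simp⟩) (N n)
    have hrs : ∀ n x, r n x ≤ s n x := fun n x => by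
      have := hr n (0, x)
      rw [hN] at this
      simpa using this
    have hra : ∀ n m, m ≤ n → ∀ y : Y m, r n (f m y) ≤ a m * ‖y‖ := fun n m hmn y => by
      obtain ⟨y', h1, h2⟩ := hlink m n hmn y
      have := hr n (y', 0)
      rw [hN, LinearMap.coprod_apply, h1] at this
      simp only [map_zero, add_zero] at this
      exact this.trans h2
    have hbound : ∀ m (y : Y m) n,
        r n (f m y) ≤ a m * ‖y‖ + ∑ i ∈ Finset.range m, s i (f m y) := by
      intro m y n
      have h1 : 0 ≤ a m * ‖y‖ := mul_nonneg (ha m).le (norm_nonneg y)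
      have h2 : 0 ≤ ∑ i ∈ Finset.range m, s i (f m y) :=
        Finset.sum_nonneg fun i _ => apply_nonneg _ _
      rcases le_or_gt m n with hmn | hmn
      · linarith [hra n m hmn y]
      · have h3 : s n (f m y) ≤ ∑ i ∈ Finset.range m, s i (f m y) :=
          Finset.single_le_sum (f := fun i => s i (f m y)) (fun i _ => apply_nonneg _ _)
            (Finset.mem_range.2 hmn)
        linarith [hrs n (f m y)]
    have hbdd : BddAbove (Set.range r) := by
      rw [Seminorm.bddAbove_range_iff]
      intro x
      obtain ⟨m, y, rfl⟩ := hsurj x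
      exact ⟨_, by rintro _ ⟨n, rfl⟩; exact hbound m y n⟩
    let p : Seminorm 𝕜 E := ⨆ n, r n
    have hrp : ∀ n x, r n x ≤ p x := fun n x => le_ciSup hbdd n x
    have hp : Continuous p := by
      refine lcFinal.continuous_seminorm ht p fun m => ?_
      let q : Seminorm 𝕜 (Y m) := NNReal.mk (a m) (ha m).le • normSeminorm 𝕜 (Y m) +
        ∑ i ∈ Finset.range m, (s i).comp (f m)
      have hq : ∀ y, q y = a m * ‖y‖ + ∑ i ∈ Finset.range m, s i (f m y) := fun y => by
        change _ + (∑ i ∈ Finset.range m, (s i).comp (f m)) y = _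
        rw [_root_.sum_apply]
        rfl
      have hqc : Continuous q := by
        have : (q : Y m → ℝ) = fun y => a m * ‖y‖ + ∑ i ∈ Finset.range m, s i (f m y) :=
          funext hq
        rw [this]
        have := fun i => (hs i).comp (lcFinal.continuous_step ht m)
        exact (continuous_const.mul continuous_norm).add
          (continuous_finsetSum _ fun i _ => this i)
      refine Seminorm.continuous_of_le (p := p.comp (f m)) hqc fun y => ?_
      change p (f m y) ≤ q y
      rw [hq, Seminorm.iSup_apply hbdd]
      exact ciSup_le fun n => hbound m y n
    obtain ⟨A₀, hA₀, hA₀p⟩ := hcauchy p hp 1 one_pos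
    obtain ⟨x₀, hx₀⟩ := hFne.nonempty_of_mem hA₀
    obtain ⟨m₀, y₀, rfl⟩ := hsurj x₀
    obtain ⟨m₁, hm₁⟩ := exists_nat_ge (a m₀ * ‖y₀‖)
    let m := max m₀ m₁
    obtain ⟨y₁, hy₁, hy₁a⟩ := hlink m₀ m (le_max_left _ _) y₀
    obtain ⟨x, hx, hxm⟩ := hFne.nonempty_of_mem (inter_mem hA₀ (hA m))
    obtain ⟨⟨y, u⟩, hyu, hlt⟩ := hr' m (x - f m₀ y₀) 1
      ((hrp m _).trans_lt (hA₀p _ hx₀ x hx))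
    rw [hN] at hlt
    have hay : 0 ≤ a m * ‖y‖ := mul_nonneg (ha m).le (norm_nonneg y)
    refine hAs m x hxm u (by linarith) (y₁ + y) ?_ ?_
    · rw [le_div_iff₀ (ha m), mul_comm]
      have h1 : (m₁ : ℝ) ≤ m := by exact_mod_cast le_max_right m₀ m₁
      have h2 := mul_le_mul_of_nonneg_left (norm_add_le y₁ y) (ha m).le
      linarith [apply_nonneg (s m) u]
    · have h1 : f m y + u = x - f m₀ y₀ := hyu
      rw [map_add, hy₁, ← sub_eq_zero]
      have h2 : f m₀ y₀ + f m y - (x - u) = f m y + u - (x - f m₀ y₀) := by abel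
      rw [h2, h1, sub_self]
  obtain ⟨n, R, hn⟩ := hmeet
  -- The ball is relatively compact in the next step, where a cluster point is found.
  let K : Set E := f (n + 1) '' closure (c n '' Metric.closedBall 0 R)
  have hK : IsCompact K := by
    refine IsCompact.image ?_ (lcFinal.continuous_step ht (n + 1))
    exact IsCompactOperator.isCompact_closure_image_closedBall
      (f := (c n : Y n →ₗ[𝕜] Y (n + 1))) (hc n) R
  let G : Filter E := map (fun z : E × E => z.1 - z.2) (F ×ˢ 𝓝 0)
  have hGK : (G ⊓ 𝓟 K).NeBot := by
    rw [inf_principal_neBot_iff]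
    intro V hV
    obtain ⟨A, hA, B, hB, hAB⟩ := mem_prod_iff.1 (mem_map.1 hV)
    obtain ⟨s, hs, hsB⟩ := lcFinal.exists_seminorm_of_mem_nhds ht hB
    obtain ⟨x, hx, u, hu, y, hy, hyx⟩ := hn A hA s hs
    refine ⟨x - u, hAB (Set.mk_mem_prod hx (hsB u hu)), c n y, subset_closure ⟨y, ?_, rfl⟩, ?_⟩
    · rwa [mem_closedBall_zero_iff]
    · rw [hcf, hyx]
  obtain ⟨x₀, -, hx₀⟩ := hK (f := G ⊓ 𝓟 K) inf_le_right
  have hx₀G : ClusterPt x₀ G := hx₀.mono inf_le_left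
  refine ⟨x₀, ?_⟩
  -- A cluster point of the perturbed filter is a limit of the Cauchy filter.
  intro V hV
  have hV0 : (fun z => x₀ + z) ⁻¹' V ∈ 𝓝 (0 : E) :=
    (continuous_const_add x₀).continuousAt.preimage_mem_nhds (by simpa using hV)
  obtain ⟨s, hs, hsV⟩ := lcFinal.exists_seminorm_of_mem_nhds ht hV0
  obtain ⟨A, hA, hAs⟩ := hcauchy s hs (1 / 3) (by norm_num)
  have hB : {u | s u < 1 / 3} ∈ 𝓝 (0 : E) :=
    (isOpen_lt hs continuous_const).mem_nhds (by simp)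
  have hAB : (fun z : E × E => z.1 - z.2) '' (A ×ˢ {u | s u < 1 / 3}) ∈ G :=
    image_mem_map (prod_mem_prod hA hB)
  have hx₀n : {z | s (z - x₀) < 1 / 3} ∈ 𝓝 x₀ :=
    (isOpen_lt (hs.comp (continuous_id.sub continuous_const)) continuous_const).mem_nhds
      (by simp)
  obtain ⟨_, hz, ⟨x, u⟩, ⟨hx, hu⟩, rfl⟩ := clusterPt_iff_nonempty.1 hx₀G hx₀n hAB
  refine mem_of_superset hA fun v hv => ?_
  have h1 := hAs x hx v hv
  have hz' : s (x - u - x₀) < 1 / 3 := hz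
  have hu' : s u < 1 / 3 := hu
  have h2 : v - x₀ = (v - x) + u + (x - u - x₀) := by abel
  have h3 : s (v - x₀) < 1 := by
    rw [h2]
    linarith [map_add_le_add s (v - x + u) (x - u - x₀), map_add_le_add s (v - x) u]
  have := hsV _ h3
  simpa using this

end Silva

/-! ### Inductive limits with a compact cofinal sequence -/

namespace LCLim

universe u v w

variable {𝕜 : Type w} [RCLike 𝕜] {ι : Type v} [Preorder ι] {X : ι → Type u}
  [∀ i, NormedAddCommGroup (X i)] [∀ i, NormedSpace 𝕜 (X i)]
  {b : ∀ i j, i ≤ j → X i →ₗ[𝕜] X j}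

theorem of_b {i j : ι} (h : i ≤ j) (x : X i) : of 𝕜 X b j (b i j h x) = of 𝕜 X b i x := by
  classical exact Module.DirectLimit.of_f

theorem lift_of {G : Type*} [AddCommGroup G] [Module 𝕜 G] (g : ∀ i, X i →ₗ[𝕜] G)
    (hg : ∀ i j hij x, g j (b i j hij x) = g i x) (i : ι) (x : X i) :
    lift 𝕜 X b g hg (of 𝕜 X b i x) = g i x := by
  classical exact Module.DirectLimit.lift_of _ _ _

theorem lift_injective [IsDirectedOrder ι] {G : Type*} [AddCommGroup G] [Module 𝕜 G]
    (g : ∀ i, X i →ₗ[𝕜] G) (hg : ∀ i j hij x, g j (b i j hij x) = g i x)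
    (h : ∀ i, Function.Injective (g i)) : Function.Injective (lift 𝕜 X b g hg) := by
  classical exact Module.DirectLimit.lift_injective _ _ h

theorem exists_of [Nonempty ι] [IsDirectedOrder ι] (z : LCLim 𝕜 X b) :
    ∃ i x, of 𝕜 X b i x = z := by
  classical exact Module.DirectLimit.exists_of z

theorem exists_of_seq [Nonempty ι] [IsDirectedOrder ι] {a : ℕ → ι} (hcof : ∀ i, ∃ n, i ≤ a n)
    (z : LCLim 𝕜 X b) : ∃ n x, of 𝕜 X b (a n) x = z := by
  obtain ⟨i, x, rfl⟩ := exists_of z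
  obtain ⟨n, hn⟩ := hcof i
  exact ⟨n, b i (a n) hn x, of_b hn x⟩

/-- A cofinal sequence of steps determines the topology of the inductive limit. -/
theorem topology_eq_lcFinal_seq (hb : ∀ i j h, Continuous (b i j h)) {a : ℕ → ι}
    (hcof : ∀ i, ∃ n, i ≤ a n) :
    (inferInstance : TopologicalSpace (LCLim 𝕜 X b)) = lcFinal 𝕜 fun n => of 𝕜 X b (a n) := by
  refine lcFinal_congr fun p => ⟨fun h n => h (a n), fun h i => ?_⟩
  obtain ⟨n, hn⟩ := hcof i
  refine ((h n).comp (hb i (a n) hn)).congr fun x => ?_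
  change p (of 𝕜 X b (a n) (b i (a n) hn x)) = _
  rw [of_b]

/-- An inductive limit of Banach spaces with injective canonical maps is a Silva space if it has a
cofinal sequence of steps with compact linking maps. -/
theorem isSilva {𝕜 : Type w} [RCLike 𝕜] {ι : Type u} [Preorder ι] {X : ι → Type u}
    [∀ i, NormedAddCommGroup (X i)] [∀ i, NormedSpace 𝕜 (X i)]
    {b : ∀ i j, i ≤ j → X i →ₗ[𝕜] X j} [Nonempty ι] [IsDirectedOrder ι]
    [∀ i, CompleteSpace (X i)] (hb : ∀ i j h, Continuous (b i j h))
    (hinj : ∀ i, Function.Injective (of 𝕜 X b i)) {a : ℕ → ι} (ha : Monotone a)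
    (hcof : ∀ i, ∃ n, i ≤ a n)
    (hcomp : ∀ n, IsCompactOperator (b (a n) (a (n + 1)) (ha n.le_succ))) :
    IsSilva 𝕜 (LCLim 𝕜 X b) :=
  ⟨fun n => X (a n), fun _ => inferInstance, fun _ => inferInstance, fun _ => inferInstance,
    fun n => ⟨b (a n) (a (n + 1)) (ha n.le_succ), hb _ _ _⟩, fun n => of 𝕜 X b (a n), hcomp,
    fun _ => hinj _, fun _ _ => of_b _ _, exists_of_seq hcof, topology_eq_lcFinal_seq hb hcof⟩

/-- If the product of germs maps pairs of steps boundedly into some step, then the limit is a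
locally convex algebra. -/
theorem isPointwiseLCAlgebra [Nonempty ι] [IsDirectedOrder ι]
    (hb : ∀ i j h, Continuous (b i j h)) {a : ℕ → ι} (hcof : ∀ i, ∃ n, i ≤ a n)
    {α : Type*} {l : Filter α} [Module 𝕜 (Germ l ℂ)] (γ : LCLim 𝕜 X b →ₗ[𝕜] Germ l ℂ)
    (hγ : Function.Injective γ) (hone : ∃ e, γ e = 1)
    (hsmul : ∀ (c : 𝕜) (x y : Germ l ℂ), (c • x) * y = c • (x * y))
    (hmul : ∀ i j, ∃ (k : ι) (m : X i → X j → X k) (C : ℝ),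
      (∀ x y, ‖m x y‖ ≤ C * (‖x‖ * ‖y‖)) ∧
      ∀ x y, γ (of 𝕜 X b k (m x y)) = γ (of 𝕜 X b i x) * γ (of 𝕜 X b j y)) :
    IsPointwiseLCAlgebra 𝕜 γ := by
  refine ⟨inferInstance, inferInstance, (withSeminorms 𝕜 X b).toPolynormableSpace, hγ, hone, ?_⟩
  have hprod : ∀ x y : LCLim 𝕜 X b, ∃ z, γ z = γ x * γ y := by
    intro x y
    obtain ⟨i, x, rfl⟩ := exists_of x
    obtain ⟨j, y, rfl⟩ := exists_of y
    obtain ⟨k, m, -, -, hm⟩ := hmul i j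
    exact ⟨_, hm x y⟩
  choose M hM using hprod
  let mul : LCLim 𝕜 X b →ₗ[𝕜] LCLim 𝕜 X b →ₗ[𝕜] LCLim 𝕜 X b := LinearMap.mk₂ 𝕜 M
    (fun x x' y => hγ (by simp only [hM, map_add, add_mul]))
    (fun c x y => hγ (by simp only [hM, map_smul, hsmul]))
    (fun x y y' => hγ (by simp only [hM, map_add, mul_add]))
    (fun c x y => hγ (by
      simp only [hM, map_smul]
      rw [mul_comm, hsmul, mul_comm]))
  refine ⟨mul, hM, ?_⟩
  have hseq := topology_eq_lcFinal_seq (𝕜 := 𝕜) (X := X) hb hcof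
  have hbound : ∀ q : Seminorm 𝕜 (LCLim 𝕜 X b), (∀ i, Continuous fun x => q (of 𝕜 X b i x)) →
      ∃ p : Seminorm 𝕜 (LCLim 𝕜 X b), Continuous p ∧ ∀ x y, q (mul x y) ≤ p x * p y := by
    intro q hq
    obtain ⟨p, hp, hpq⟩ := exists_seminorm_mul_le (f := fun n => of 𝕜 X b (a n))
      (exists_of_seq hcof) mul q fun n m => by
        obtain ⟨k, mk, C, hC, hmk⟩ := hmul (a n) (a m)
        obtain ⟨D, hD, hDq⟩ := Seminorm.bound_of_continuous_normedSpace
          (q.comp (of 𝕜 X b k)) (hq k)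
        refine ⟨D * C, fun x y => ?_⟩
        have e : mul (of 𝕜 X b (a n) x) (of 𝕜 X b (a m) y) = of 𝕜 X b k (mk x y) :=
          hγ ((hM _ _).trans (hmk x y).symm)
        rw [e, mul_assoc]
        exact (hDq _).trans (mul_le_mul_of_nonneg_left (hC x y) hD.le)
    exact ⟨p, lcFinal.continuous_seminorm hseq p hp, hpq⟩
  rw [continuous_iff_continuousAt]
  rintro ⟨x₀, y₀⟩
  refine ((withSeminorms 𝕜 X b).tendsto_nhds _ _).2 fun q ε hε => ?_
  obtain ⟨p, hp, hpq⟩ := hbound q.1 q.2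
  let g : LCLim 𝕜 X b × LCLim 𝕜 X b → ℝ := fun z =>
    p (z.1 - x₀) * p (z.2 - y₀) + p x₀ * p (z.2 - y₀) + p (z.1 - x₀) * p y₀
  have hg : Continuous g := by
    have h1 : Continuous fun z : LCLim 𝕜 X b × LCLim 𝕜 X b => p (z.1 - x₀) :=
      hp.comp (continuous_fst.sub continuous_const)
    have h2 : Continuous fun z : LCLim 𝕜 X b × LCLim 𝕜 X b => p (z.2 - y₀) :=
      hp.comp (continuous_snd.sub continuous_const)
    exact ((h1.mul h2).add (continuous_const.mul h2)).add (h1.mul continuous_const)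
  have hg0 : g (x₀, y₀) = 0 := by simp [g]
  have hev : ∀ᶠ z in 𝓝 (x₀, y₀), g z < ε :=
    hg.continuousAt.eventually_lt_const (by rw [hg0]; exact hε)
  filter_upwards [hev] with z hz
  refine lt_of_le_of_lt ?_ hz
  have e : mul z.1 z.2 - mul x₀ y₀ =
      mul (z.1 - x₀) (z.2 - y₀) + mul x₀ (z.2 - y₀) + mul (z.1 - x₀) y₀ := by
    simp only [map_sub, LinearMap.sub_apply]
    abel
  change q.1 (mul z.1 z.2 - mul x₀ y₀) ≤ _
  rw [e]
  refine (map_add_le_add q.1 _ _).trans (add_le_add ?_ (hpq _ _))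
  exact (map_add_le_add q.1 _ _).trans (add_le_add (hpq _ _) (hpq _ _))

/-- Continuous maps between the steps of two inductive limits which are compatible with invariants
`δ i` and `γ` separating points induce a continuous injection of the limits. -/
theorem exists_continuous_injective [IsDirectedOrder ι] {κ : Type*} [Preorder κ] {Z : κ → Type*}
    [∀ i, NormedAddCommGroup (Z i)] [∀ i, NormedSpace 𝕜 (Z i)]
    {d : ∀ i j, i ≤ j → Z i →ₗ[𝕜] Z j} {G : Type*} [AddCommGroup G] [Module 𝕜 G]
    {γ : LCLim 𝕜 Z d →ₗ[𝕜] G} (hγ : Function.Injective γ) {δ : ∀ i, X i → G}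
    (hδ : ∀ i, Function.Injective (δ i)) (hδb : ∀ i j hij x, δ j (b i j hij x) = δ i x)
    (s : ι → κ) (T : ∀ i, X i →ₗ[𝕜] Z (s i)) (hT : ∀ i, Continuous (T i))
    (hγT : ∀ i x, γ (of 𝕜 Z d (s i) (T i x)) = δ i x) :
    ∃ j : LCLim 𝕜 X b →L[𝕜] LCLim 𝕜 Z d, Function.Injective j ∧
      ∀ i x, γ (j (of 𝕜 X b i x)) = δ i x := by
  have hc : ∀ i j hij x, of 𝕜 Z d (s j) (T j (b i j hij x)) = of 𝕜 Z d (s i) (T i x) :=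
    fun i j hij x => hγ (by rw [hγT, hγT, hδb])
  let g : ∀ i, X i →ₗ[𝕜] LCLim 𝕜 Z d := fun i => of 𝕜 Z d (s i) ∘ₗ T i
  have hcont : Continuous (lift 𝕜 X b g hc) := by
    refine lcFinal.continuous_linearMap (f := of 𝕜 X b) rfl (withSeminorms 𝕜 Z d) _ fun i => ?_
    simp only [lift_of]
    exact (lcFinal.continuous_step (f := of 𝕜 Z d) rfl (s i)).comp (hT i)
  refine ⟨⟨lift 𝕜 X b g hc, hcont⟩, lift_injective g hc fun i x y h => hδ i ?_, fun i x => ?_⟩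
  · rw [← hγT, ← hγT]
    exact congrArg γ h
  · exact (congrArg γ (lift_of g hc i x)).trans (hγT i x)

end LCLim

section Balls

/-! ### Holomorphic functions on open subsets of normed spaces -/

section Holomorphic

variable {E : Type*} [NormedAddCommGroup E]

/-- Holomorphic functions bounded by `M` on a ball of radius `δ` satisfy the Schwarz lemma with
oscillation `2 * M`. -/
theorem mapsTo_closedBall_of_norm_le {F : E → ℂ} {z : E} {δ M : ℝ} (hδ : 0 < δ)
    (hM : ∀ w ∈ Metric.ball z δ, ‖F w‖ ≤ M) :
    Set.MapsTo F (Metric.ball z δ) (Metric.closedBall (F z) (2 * M)) := fun w hw => by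
  rw [mem_closedBall_iff_norm]
  linarith [norm_sub_le (F w) (F z), hM w hw, hM z (Metric.mem_ball_self hδ)]

/-- Weierstrass' theorem: uniform limits of holomorphic functions are holomorphic. -/
theorem differentiableOn_of_tendstoUniformlyOn [NormedSpace ℂ E] {Ω : Set E} (hΩ : IsOpen Ω) {F : ℕ → E → ℂ}
    (hF : ∀ n, DifferentiableOn ℂ (F n) Ω) {f : E → ℂ} (h : TendstoUniformlyOn F f atTop Ω) :
    DifferentiableOn ℂ f Ω := by
  intro z₀ hz₀
  obtain ⟨r, hr, hrΩ⟩ := Metric.isOpen_iff.1 hΩ z₀ hz₀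
  let δ := r / 2
  have hδ : 0 < δ := half_pos hr
  have hδr : δ + δ = r := add_halves r
  have hsub : ∀ z ∈ Metric.ball z₀ δ, Metric.ball z δ ⊆ Ω := fun z hz w hw => hrΩ <| by
    rw [Metric.mem_ball] at *
    linarith [dist_triangle w z z₀]
  have hdiff : ∀ n, ∀ z ∈ Metric.ball z₀ δ, DifferentiableAt ℂ (F n) z := fun n z hz =>
    (hF n).differentiableAt (hΩ.mem_nhds (hsub z hz (Metric.mem_ball_self hδ)))
  -- By the Cauchy estimates, the derivatives converge uniformly near `z₀`.
  have hcauchy : UniformCauchySeqOn (fun n z => fderiv ℂ (F n) z) atTop (Metric.ball z₀ δ) := by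
    rw [Metric.uniformCauchySeqOn_iff]
    intro ε hε
    obtain ⟨N, hN⟩ := Metric.uniformCauchySeqOn_iff.1 h.uniformCauchySeqOn (ε * δ / 4)
      (by positivity)
    refine ⟨N, fun m hm n hn z hz => ?_⟩
    rw [dist_eq_norm, ← fderiv_sub (hdiff m z hz) (hdiff n z hz)]
    have hbd : ∀ w ∈ Metric.ball z δ, ‖(F m - F n) w‖ ≤ ε * δ / 4 := fun w hw => by
      have := hN m hm n hn w (hsub z hz hw)
      rw [dist_eq_norm] at this
      exact this.le
    have := Complex.norm_fderiv_le_div_of_mapsTo_ball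
      (((hF m).sub (hF n)).mono (hsub z hz)) (mapsTo_closedBall_of_norm_le hδ hbd) hδ
    refine this.trans_lt ?_
    rw [div_lt_iff₀ hδ]
    nlinarith [mul_pos hε hδ]
  have hlim : ∀ z, ∃ g' : E →L[ℂ] ℂ, z ∈ Metric.ball z₀ δ →
      Tendsto (fun n => fderiv ℂ (F n) z) atTop (𝓝 g') := fun z => by
    by_cases hz : z ∈ Metric.ball z₀ δ
    · obtain ⟨g', hg'⟩ := cauchySeq_tendsto_of_complete (hcauchy.cauchySeq hz)
      exact ⟨g', fun _ => hg'⟩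
    · exact ⟨0, fun h => absurd h hz⟩
  choose g' hg' using hlim
  refine (hasFDerivAt_of_tendstoUniformlyOn (g := f) Metric.isOpen_ball
    (hcauchy.tendstoUniformlyOn_of_tendsto hg') (fun n z hz => (hdiff n z hz).hasFDerivAt)
    (fun z hz => h.tendsto_at (hsub z hz (Metric.mem_ball_self hδ)))
    (Metric.mem_ball_self hδ)).differentiableAt.differentiableWithinAt

end Holomorphic

/-! ### Restriction of bounded holomorphic functions -/

variable {k : ℕ}

theorem IP.norm_smul (Q : IP k) (t : ℂ) (z : Fin k → ℂ) : Q.norm (t • z) = ‖t‖ * Q.norm z := by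
  have h : Q.inner (t • z) (t • z) = ((‖t‖ ^ 2 : ℝ) : ℂ) * Q.inner z z := by
    rw [Q.smul_left, ← Q.conj_inner_symm, Q.smul_left, map_mul, Q.conj_inner_symm,
      Complex.conj_conj, ← mul_assoc, Complex.conj_mul']
    push_cast
    rfl
  unfold IP.norm
  rw [h, Complex.re_ofReal_mul, Real.sqrt_mul (by positivity), Real.sqrt_sq (norm_nonneg t)]

theorem isClosed_BHolC (Q : IP k) (n : ℕ+) : IsClosed (BHolC Q n : Set (ball Q n →ᵇ ℂ)) := by
  refine IsSeqClosed.isClosed fun u f hu huf => ?_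
  choose F hF hFu using hu
  refine ⟨Function.extend Subtype.val f 0, differentiableOn_of_tendstoUniformlyOn
    (ball Q n).isOpen hF ?_, fun z => (Subtype.val_injective.extend_apply f 0 z).symm⟩
  rw [Metric.tendstoUniformlyOn_iff]
  intro ε hε
  filter_upwards [(Metric.tendsto_nhds.1 huf) ε hε] with m hm z hz
  rw [Subtype.val_injective.extend_apply f 0 ⟨z, hz⟩, ← hFu m ⟨z, hz⟩, dist_comm]
  exact (BoundedContinuousFunction.dist_coe_le_dist _).trans_lt hm

instance (Q : IP k) (n : ℕ+) : CompleteSpace (BHolC Q n) :=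
  (isClosed_BHolC Q n).completeSpace_coe

theorem norm_apply_le (Q : IP k) {n : ℕ+} (f : BHolC Q n) (z : ball Q n) : ‖f.1 z‖ ≤ ‖f‖ :=
  f.1.norm_coe_le_norm z

theorem norm_le_of_forall (Q : IP k) {n : ℕ+} (f : BHolC Q n) {C : ℝ} (hC : 0 ≤ C)
    (h : ∀ z, ‖f.1 z‖ ≤ C) : ‖f‖ ≤ C :=
  (BoundedContinuousFunction.norm_le hC).2 h

/-- Montel's theorem: the restriction to a strictly smaller ball is compact. -/
theorem BHolC.isCompactOperator_res (Q : IP k) {n m : ℕ+} (h : n < m) :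
    IsCompactOperator (BHolC.res Q n m h.le) := by
  let K : Set (Fin k → ℂ) := {z | Q.norm z ≤ 1 / (m : ℝ)}
  have hK : IsCompact K := by
    refine Metric.isCompact_of_isClosed_isBounded
      (isClosed_le Q.norm_spec.1 continuous_const) ?_
    obtain ⟨C, hC⟩ := Q.norm_spec.2
    refine isBounded_iff_forall_norm_le.2 ⟨|C| * (1 / (m : ℝ)), fun z hz => (hC z).trans ?_⟩
    exact mul_le_mul (le_abs_self C) hz (Real.sqrt_nonneg _) (abs_nonneg C)
  have hmn : 1 / (m : ℝ) < 1 / (n : ℝ) :=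
    one_div_lt_one_div_of_lt (by exact_mod_cast n.pos) (by exact_mod_cast h)
  have hKn : K ⊆ ball Q n := fun z hz => lt_of_le_of_lt (show Q.norm z ≤ _ from hz) hmn
  have hmK : (ball Q m : Set (Fin k → ℂ)) ⊆ K := fun z hz =>
    (show Q.norm z < 1 / (m : ℝ) from hz).le
  obtain ⟨δ, hδ, hδn⟩ := hK.exists_thickening_subset_open (ball Q n).isOpen hKn
  have hδz : ∀ z ∈ K, Metric.ball z δ ⊆ ball Q n := fun z hz =>
    (Metric.ball_subset_thickening hz δ).trans hδn
  have : CompactSpace K := isCompact_iff_compactSpace.1 hK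
  let ρ : BHolC Q n → (K →ᵇ ℂ) := fun f =>
    f.1.compContinuous ⟨fun z => ⟨z, hKn z.2⟩, by fun_prop⟩
  let σ : (K →ᵇ ℂ) → (ball Q m →ᵇ ℂ) := fun g =>
    g.compContinuous ⟨fun z => ⟨z, hmK z.2⟩, by fun_prop⟩
  have hσ : Continuous σ := BoundedContinuousFunction.continuous_compContinuous _
  have hcomp : IsCompact (closure (ρ '' Metric.closedBall 0 1)) := by
    refine BoundedContinuousFunction.arzela_ascoli (Metric.closedBall 0 1)
      (isCompact_closedBall _ _) _ ?_ ?_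
    · rintro _ z ⟨f, hf, rfl⟩
      rw [mem_closedBall_zero_iff] at *
      exact (norm_apply_le Q f _).trans hf
    · intro z
      rw [Metric.equicontinuousAt_iff]
      intro ε hε
      refine ⟨min δ (δ * ε / 2), by positivity, ?_⟩
      rintro w hw ⟨_, f, hf, rfl⟩
      rw [mem_closedBall_zero_iff] at hf
      obtain ⟨F, hF, hFf⟩ := f.2
      have hbd : ∀ v ∈ Metric.ball z.1 δ, ‖F v‖ ≤ 1 := fun v hv => by
        rw [← hFf ⟨v, hδz z z.2 hv⟩]
        exact (norm_apply_le Q f _).trans hf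
      have hwz : dist w.1 z.1 < min δ (δ * ε / 2) := hw
      have hw1 : w.1 ∈ Metric.ball z.1 δ := hwz.trans_le (min_le_left _ _)
      have h1 := Complex.dist_le_div_mul_dist_of_mapsTo_ball (hF.mono (hδz z z.2))
        (mapsTo_closedBall_of_norm_le hδ hbd) hw1
      have e : ∀ v : K, ρ f v = F v.1 := fun v => hFf ⟨v, hKn v.2⟩
      change dist (ρ f z) (ρ f w) < ε
      rw [e, e, dist_comm]
      refine h1.trans_lt ?_
      rw [div_mul_eq_mul_div, div_lt_iff₀ hδ]
      linarith [hwz.trans_le (min_le_right _ _)]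
  have hcompact : IsCompactOperator fun f : BHolC Q n => (BHolC.res Q n m h.le f).1 := by
    refine ⟨_, hcomp.image hσ, mem_of_superset (Metric.closedBall_mem_nhds 0 one_pos) ?_⟩
    exact fun f hf => ⟨ρ f, subset_closure ⟨f, hf, rfl⟩, rfl⟩
  exact hcompact.codRestrict (V := BHolC Q m) (fun f => (BHolC.res Q n m h.le f).2)
    (isClosed_BHolC Q m)

/-- Identity theorem: the restriction to complex lines through `0` reduces it to one variable. -/
theorem BHolC.eq_zero_of_eventually (Q : IP k) {n : ℕ+} (f : BHolC Q n) {F : (Fin k → ℂ) → ℂ}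
    (hFf : ∀ z : ball Q n, f.1 z = F z) (h0 : ∀ᶠ z in 𝓝 0, F z = 0) : f = 0 := by
  obtain ⟨G, hG, hGf⟩ := f.2
  have hGF : ∀ z ∈ ball Q n, G z = F z := fun z hz => (hGf ⟨z, hz⟩).symm.trans (hFf ⟨z, hz⟩)
  ext z
  let U : Set ℂ := {t | ‖t‖ * Q.norm z < 1 / (n : ℝ)}
  have hU : ∀ t, t ∈ U ↔ t • z.1 ∈ ball Q n := fun t => by
    change _ ↔ Q.norm (t • z.1) < _
    rw [IP.norm_smul]
    rfl
  have hz0 : 0 ≤ Q.norm z := Real.sqrt_nonneg _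
  have hUo : IsOpen U := isOpen_lt (by fun_prop) continuous_const
  have hUc : Convex ℝ U := by
    intro s hs t ht a b ha hb hab
    have hs' : ‖s‖ * Q.norm z < 1 / (n : ℝ) := hs
    have ht' : ‖t‖ * Q.norm z < 1 / (n : ℝ) := ht
    have h1 : ‖a • s + b • t‖ ≤ a * ‖s‖ + b * ‖t‖ := by
      refine (norm_add_le _ _).trans_eq ?_
      rw [_root_.norm_smul, _root_.norm_smul, Real.norm_of_nonneg ha, Real.norm_of_nonneg hb]
    have h2 := mul_le_mul_of_nonneg_right h1 hz0
    change ‖a • s + b • t‖ * Q.norm z < _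
    rcases ha.eq_or_lt with rfl | ha
    · have : b = 1 := by linarith
      subst this
      linarith
    · have h3 : a * (1 / (n : ℝ)) + b * (1 / (n : ℝ)) = 1 / (n : ℝ) := by
        rw [← add_mul, hab, one_mul]
      linarith [mul_lt_mul_of_pos_left hs' ha, mul_le_mul_of_nonneg_left ht'.le hb]
  have hg : DifferentiableOn ℂ (fun t : ℂ => G (t • z.1)) U :=
    hG.comp (by fun_prop) fun t ht => (hU t).1 ht
  have htend : Tendsto (fun t : ℂ => t • z.1) (𝓝 0) (𝓝 0) :=
    Continuous.tendsto' (by fun_prop) _ _ (zero_smul _ _)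
  have h0U : (0 : ℂ) ∈ U := by
    change ‖(0 : ℂ)‖ * _ < _
    simp
  have hev : (fun t : ℂ => G (t • z.1)) =ᶠ[𝓝 0] 0 := by
    filter_upwards [htend.eventually h0, hUo.mem_nhds h0U] with t ht htU
    rw [hGF _ ((hU t).1 htU), ht]
    rfl
  have h1U : (1 : ℂ) ∈ U := (hU 1).2 (by rw [one_smul]; exact z.2)
  have := (hg.analyticOnNhd hUo).eqOn_zero_of_preconnected_of_eventuallyEq_zero
    hUc.isPreconnected h0U hev h1U
  simp only [one_smul, Pi.zero_apply] at this
  rw [hGf z, this]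
  rfl

end Balls

section Poles

variable {k : ℕ} {𝓛 : GeneratingSet k}

/-! ### The divisibility order on poles -/

instance : Mul (Pole 𝓛) := ⟨fun P R => ⟨P.fn * R.fn, 𝓛.semigroup.mul_mem P.2 R.2⟩⟩

theorem Pole.mul_fn (P R : Pole 𝓛) : (P * R).fn = P.fn * R.fn := rfl

theorem Pole.le_mul_right (P R : Pole 𝓛) : P ≤ P * R := Or.inr ⟨R, by rw [mul_fn, mul_comm]⟩

theorem Pole.le_mul_left (P R : Pole 𝓛) : R ≤ P * R := Or.inr ⟨P, mul_fn P R⟩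

instance : Nonempty (Pole 𝓛) := by
  obtain ⟨L, hL⟩ := 𝓛.nonempty
  exact ⟨⟨fun z => L z, Subsemigroup.subset_closure ⟨L, hL, rfl⟩⟩⟩

instance : IsDirectedOrder (Pole 𝓛) :=
  ⟨fun P R => ⟨P * R, P.le_mul_right R, P.le_mul_left R⟩⟩

instance : IsDirectedOrder (Idx 𝓛) := ⟨fun i j =>
  ⟨(max i.1 j.1, i.2 * j.2), ⟨le_max_left _ _, Pole.le_mul_right _ _⟩,
    ⟨le_max_right _ _, Pole.le_mul_left _ _⟩⟩⟩

instance : Countable (Pole 𝓛) := by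
  have : Countable 𝓛.forms := 𝓛.countable.to_subtype
  let φ : List 𝓛.forms → (Fin k → ℂ) → ℂ := fun l => (l.map fun L z => L.1 z).prod
  refine ((Set.countable_range φ).mono fun P hP => ?_ : {P | P ∈ 𝓛.semigroup}.Countable).to_subtype
  refine Subsemigroup.closure_induction (p := fun P _ => P ∈ Set.range φ) ?_ ?_ hP
  · rintro _ ⟨L, hL, rfl⟩
    exact ⟨[⟨L, hL⟩], by simp [φ]⟩
  · rintro _ _ _ _ ⟨l, rfl⟩ ⟨l', rfl⟩
    exact ⟨l ++ l', by simp [φ]⟩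

variable (𝓛) in
/-- The index set has a cofinal sequence along which the balls shrink strictly: the `n`-th pole is
the product of the first `n + 1` poles of an enumeration. -/
theorem exists_cofinal_seq : ∃ a : ℕ → Idx 𝓛, Monotone a ∧ (∀ n, (a n).1 < (a (n + 1)).1) ∧
    ∀ i, ∃ n, i ≤ a n := by
  obtain ⟨e, he⟩ := exists_surjective_nat (Pole 𝓛)
  let p : ℕ → Pole 𝓛 := fun n => Nat.rec (e 0) (fun n P => P * e (n + 1)) n
  have hp : ∀ n, p (n + 1) = p n * e (n + 1) := fun _ => rfl
  have hpm : Monotone p := monotone_nat_of_le_succ fun n => by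
    rw [hp]
    exact Pole.le_mul_right _ _
  have hep : ∀ n, e n ≤ p n := fun n => by
    cases n with
    | zero => exact le_rfl
    | succ n => rw [hp]; exact Pole.le_mul_left _ _
  refine ⟨fun n => (n.succPNat, p n), fun m n h => ⟨Nat.succPNat_le_succPNat.2 h, hpm h⟩,
    fun n => Nat.succPNat_lt_succPNat.2 n.lt_succ_self, ?_⟩
  rintro ⟨m, P⟩
  obtain ⟨n, rfl⟩ := he P
  refine ⟨max m n, ?_, (hep n).trans (hpm (le_max_right _ _))⟩
  rw [← PNat.coe_le_coe]
  exact (le_max_left _ _).trans (Nat.le_succ _)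

/-! ### Germs along the filter of poles -/

theorem exists_pole_of_mem_poleFilter {s : Set (Fin k → ℂ)} (hs : s ∈ poleFilter 𝓛) :
    ∃ P : Pole 𝓛, ∀ᶠ z in 𝓝 0, P.fn z ≠ 0 → z ∈ s := by
  obtain ⟨U, hU, V, hV, rfl⟩ := mem_inf_iff.1 hs
  have hdir : Directed (· ≥ ·) fun P : Pole 𝓛 => 𝓟 {z | P.fn z ≠ 0} := fun P R =>
    ⟨P * R, principal_mono.2 fun z hz => left_ne_zero_of_mul hz,
      principal_mono.2 fun z hz => right_ne_zero_of_mul hz⟩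
  obtain ⟨P, hP⟩ := (mem_iInf_of_directed hdir V).1 hV
  exact ⟨P, mem_of_superset hU fun z hz hPz => ⟨hz, hP hPz⟩⟩

/-- A continuous function which vanishes near `0` off the zeros of some pole vanishes near `0`. -/
theorem eventually_eq_zero_of_poleFilter {Ω : Set (Fin k → ℂ)} (hΩ : Ω ∈ 𝓝 0)
    {F : (Fin k → ℂ) → ℂ} (hF : ContinuousOn F Ω) (h : ∀ᶠ z in poleFilter 𝓛, F z = 0) :
    ∀ᶠ z in 𝓝 0, F z = 0 := by
  obtain ⟨P, hP⟩ := exists_pole_of_mem_poleFilter h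
  obtain ⟨W, hW, hWo, hW0⟩ := mem_nhds_iff.1 (inter_mem hP hΩ)
  filter_upwards [hWo.mem_nhds hW0] with z hz
  have h1 : z ∈ closure (W ∩ {z | P.fn z ≠ 0}) := P.dense.open_subset_closure_inter hWo hz
  have h2 : ContinuousWithinAt F (W ∩ {z | P.fn z ≠ 0}) z :=
    (hF z (hW hz).2).mono fun w hw => (hW hw.1).2
  have h3 := h2.mem_closure h1 (t := {0}) fun w hw => (hW hw.1).1 hw.2
  simpa using h3

theorem germ_smul_mul {R α : Type*} [Semiring R] [Module R ℂ] [IsScalarTower R ℂ ℂ]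
    {l : Filter α} (c : R) (x y : Germ l ℂ) : (c • x) * y = c • (x * y) :=
  Germ.inductionOn₂ x y fun f g => congrArg _ (smul_mul_assoc c f g)

section Steps

variable (Q : IP k)

namespace BHolC

variable {Q} {n m : ℕ+}

/-- The extension of a bounded holomorphic function by `0` to all of `ℂ^k`. -/
abbrev extend (f : BHolC Q n) : (Fin k → ℂ) → ℂ := Function.extend Subtype.val f.1 0

theorem extend_apply (f : BHolC Q n) {z : Fin k → ℂ} (hz : z ∈ ball Q n) :
    BHolC.extend f z = f.1 ⟨z, hz⟩ :=
  Subtype.val_injective.extend_apply f.1 0 ⟨z, hz⟩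

theorem continuousOn_extend (f : BHolC Q n) : ContinuousOn (BHolC.extend f) (ball Q n) := by
  obtain ⟨F, hF, hf⟩ := f.2
  exact hF.continuousOn.congr fun z hz => (BHolC.extend_apply f hz).trans (hf ⟨z, hz⟩)

theorem germ_injective : Function.Injective (BHolC.germ Q 𝓛 n) := by
  intro f g h
  rw [← sub_eq_zero]
  refine BHolC.eq_zero_of_eventually Q (f - g) (F := BHolC.extend f - BHolC.extend g) (fun z => ?_)
    (eventually_eq_zero_of_poleFilter (𝓛 := 𝓛) (ball_mem_nhds Q n)
      ((continuousOn_extend f).sub (continuousOn_extend g)) ?_)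
  · rw [Pi.sub_apply, extend_apply _ z.2, extend_apply _ z.2]
    rfl
  · filter_upwards [Germ.coe_eq.1 h] with z hz
    exact sub_eq_zero.2 hz

theorem germ_res (h : n ≤ m) (f : BHolC Q n) :
    BHolC.germ Q 𝓛 m (BHolC.res Q n m h f) = BHolC.germ Q 𝓛 n f := by
  refine Germ.coe_eq.2 ?_
  have hm : (ball Q m : Set (Fin k → ℂ)) ∈ poleFilter 𝓛 := mem_inf_of_left (ball_mem_nhds Q m)
  filter_upwards [hm] with z hz
  exact (extend_apply _ hz).trans (extend_apply f (ball_mono Q h hz)).symm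

theorem norm_res_le (h : n ≤ m) (f : BHolC Q n) : ‖BHolC.res Q n m h f‖ ≤ ‖f‖ :=
  norm_le_of_forall Q _ (norm_nonneg f) fun _ => norm_apply_le Q f _

theorem continuous_res (h : n ≤ m) : Continuous (BHolC.res Q n m h) :=
  ((BHolC.res Q n m h).mkContinuous 1 fun f => by
    rw [one_mul]
    exact norm_res_le h f).continuous

instance : Mul (BHolC Q n) := ⟨fun f g => ⟨f.1 * g.1, by
  obtain ⟨F, hF, hf⟩ := f.2
  obtain ⟨G, hG, hg⟩ := g.2
  exact ⟨F * G, hF.mul hG, fun z => congrArg₂ (· * ·) (hf z) (hg z)⟩⟩⟩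

theorem mul_apply (f g : BHolC Q n) (z : ball Q n) : (f * g).1 z = f.1 z * g.1 z := rfl

theorem norm_mul_le (f g : BHolC Q n) : ‖f * g‖ ≤ ‖f‖ * ‖g‖ := _root_.norm_mul_le f.1 g.1

/-- Multiplication by a bounded holomorphic function. -/
def mulLeft (s : BHolC Q n) : BHolC Q n →L[ℂ] BHolC Q n :=
  LinearMap.mkContinuous
    { toFun := fun f => s * f
      map_add' := fun f g => Subtype.ext (mul_add s.1 f.1 g.1)
      map_smul' := fun c f => Subtype.ext (mul_smul_comm c s.1 f.1) } ‖s‖ (norm_mul_le s)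

variable (Q n) in
/-- The restriction of an entire function to a ball. -/
def ofEntire {S : (Fin k → ℂ) → ℂ} (hS : Differentiable ℂ S) : BHolC Q n :=
  ⟨BoundedContinuousFunction.ofNormedAddCommGroup (fun z => S z)
    (hS.continuous.comp continuous_subtype_val) (ball_bounded Q n hS.continuous).choose
    fun z => (ball_bounded Q n hS.continuous).choose_spec z z.2,
    S, hS.differentiableOn, fun _ => rfl⟩

end BHolC

namespace MerC

variable {Q} {i j : Idx 𝓛}

theorem norm_def (u : MerC Q i) : ‖u‖ = ‖(MerC.mk Q i).symm u‖ := rfl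

variable (Q i) in
/-- The bijection `f ↦ f / P` is isometric by definition of the norm. -/
def isometry : BHolC Q i.1 ≃ₗᵢ[ℂ] MerC Q i :=
  ⟨MerC.mk Q i, fun f => by rw [norm_def, LinearEquiv.symm_apply_apply]⟩

theorem isometry_apply (f : BHolC Q i.1) {z : Fin k → ℂ} (hz : z ∈ ball Q i.1 ∧ i.2.fn z ≠ 0) :
    (isometry Q i f).1 ⟨z, hz⟩ = f.1 ⟨z, hz.1⟩ / i.2.fn z := rfl

instance : CompleteSpace (MerC Q i) :=
  (isometry Q i).symm.toIsometryEquiv.completeSpace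

theorem extend_apply (u : MerC Q i) {z : Fin k → ℂ} (hz : z ∈ ball Q i.1 ∧ i.2.fn z ≠ 0) :
    (Function.extend Subtype.val u.1 0 : (Fin k → ℂ) → ℂ) z = u.1 ⟨z, hz⟩ :=
  Subtype.val_injective.extend_apply u.1 0 ⟨z, hz⟩

theorem germ_eq_iff {f : BHolC Q i.1} {F : (Fin k → ℂ) → ℂ} :
    MerC.germ Q i (isometry Q i f) = (F : Germ (poleFilter 𝓛) ℂ) ↔
      ∀ᶠ z in poleFilter 𝓛, ∀ hz : z ∈ ball Q i.1 ∧ i.2.fn z ≠ 0,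
        f.1 ⟨z, hz.1⟩ / i.2.fn z = F z := by
  refine Germ.coe_eq.trans (eventually_congr ?_)
  filter_upwards [reg_mem Q i] with z hz
  rw [extend_apply _ hz]
  exact ⟨fun h _ => h, fun h => h hz⟩

/-- Multiplying `f / P` by `P` gives back the germ of the numerator. -/
theorem germ_mul_pole (f : BHolC Q i.1) :
    MerC.germ Q i (isometry Q i f) * (i.2.fn : Germ (poleFilter 𝓛) ℂ) = BHolC.germ Q 𝓛 i.1 f := by
  refine Germ.coe_eq.2 ?_
  filter_upwards [reg_mem Q i] with z hz
  rw [extend_apply _ hz, isometry_apply, div_mul_cancel₀ _ hz.2]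
  exact (BHolC.extend_apply f hz.1).symm

theorem germ_injective : Function.Injective (MerC.germ Q i) := by
  intro u v h
  obtain ⟨f, rfl⟩ := (isometry Q i).surjective u
  obtain ⟨g, rfl⟩ := (isometry Q i).surjective v
  refine congrArg _ (BHolC.germ_injective (𝓛 := 𝓛) ?_)
  rw [← germ_mul_pole, ← germ_mul_pole, h]

/-- The inclusion of steps in terms of numerators: restriction followed by multiplication with the
cofactor of the poles. -/
theorem exists_res_eq (h : i ≤ j) : ∃ s : BHolC Q j.1,
    ∀ u, MerC.res Q i j h u =
      isometry Q j (BHolC.mulLeft s (BHolC.res Q i.1 j.1 h.1 ((isometry Q i).symm u))) := by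
  obtain ⟨S, hS, -, hR⟩ := exists_cofactor h.2
  refine ⟨BHolC.ofEntire Q j.1 hS, fun u => ?_⟩
  obtain ⟨f, rfl⟩ := (isometry Q i).surjective u
  rw [LinearIsometryEquiv.symm_apply_apply]
  refine Subtype.ext (funext fun z => ?_)
  have hz := z.2.2
  have hj : j.2.fn z = S z * i.2.fn z := congrFun hR z
  rw [hj] at hz
  have hSz : S z ≠ 0 := left_ne_zero_of_mul hz
  change f.1 _ / i.2.fn z = S z * f.1 _ / j.2.fn z
  rw [hj, mul_div_mul_left _ _ hSz]
  rfl

theorem continuous_res (h : i ≤ j) : Continuous (MerC.res Q i j h) := by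
  obtain ⟨s, hs⟩ := exists_res_eq (Q := Q) h
  rw [show ⇑(MerC.res Q i j h) = _ from funext hs]
  exact (isometry Q j).continuous.comp ((BHolC.mulLeft s).continuous.comp
    ((BHolC.continuous_res h.1).comp (isometry Q i).symm.continuous))

theorem isCompactOperator_res (h : i ≤ j) (hlt : i.1 < j.1) :
    IsCompactOperator (MerC.res Q i j h) := by
  obtain ⟨s, hs⟩ := exists_res_eq (Q := Q) h
  rw [show ⇑(MerC.res Q i j h) = _ from funext hs]
  exact (((BHolC.isCompactOperator_res Q hlt).comp_clm
    ((isometry Q i).symm : MerC Q i →L[ℂ] BHolC Q i.1)).clm_comp (BHolC.mulLeft s)).clm_comp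
    (isometry Q j : BHolC Q j.1 →L[ℂ] MerC Q j)

/-- The product of `f / P` and `g / R`, regarded as an element of a step `l` whose ball is contained
in both balls and whose pole is to be `P * R`. -/
def mul (l : Idx 𝓛) (hi : i.1 ≤ l.1) (hj : j.1 ≤ l.1) (u : MerC Q i) (v : MerC Q j) : MerC Q l :=
  isometry Q l (BHolC.res Q i.1 l.1 hi ((isometry Q i).symm u) *
    BHolC.res Q j.1 l.1 hj ((isometry Q j).symm v))

variable {l : Idx 𝓛} (hi : i.1 ≤ l.1) (hj : j.1 ≤ l.1)

theorem norm_mul_le (u : MerC Q i) (v : MerC Q j) : ‖mul l hi hj u v‖ ≤ ‖u‖ * ‖v‖ := by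
  rw [mul, LinearIsometryEquiv.norm_map]
  refine (BHolC.norm_mul_le _ _).trans ?_
  have h1 := BHolC.norm_res_le hi ((isometry Q i).symm u)
  have h2 := BHolC.norm_res_le hj ((isometry Q j).symm v)
  rw [LinearIsometryEquiv.norm_map] at h1 h2
  exact mul_le_mul h1 h2 (norm_nonneg _) (norm_nonneg _)

theorem germ_mul (hl : l.2.fn = i.2.fn * j.2.fn) (u : MerC Q i) (v : MerC Q j) :
    MerC.germ Q l (mul l hi hj u v) = MerC.germ Q i u * MerC.germ Q j v := by
  obtain ⟨f, rfl⟩ := (isometry Q i).surjective u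
  obtain ⟨g, rfl⟩ := (isometry Q j).surjective v
  rw [mul, LinearIsometryEquiv.symm_apply_apply, LinearIsometryEquiv.symm_apply_apply]
  refine Germ.coe_eq.2 ?_
  filter_upwards [reg_mem Q i, reg_mem Q j, reg_mem Q l] with z hiz hjz hlz
  have hf := (extend_apply _ hiz).trans (isometry_apply f hiz)
  have hg := (extend_apply _ hjz).trans (isometry_apply g hjz)
  have hfg := (extend_apply _ hlz).trans (isometry_apply
    (BHolC.res Q i.1 l.1 hi f * BHolC.res Q j.1 l.1 hj g) hlz)
  have hlz' : l.2.fn z = i.2.fn z * j.2.fn z := congrFun hl z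
  exact ((hfg.trans (congrArg (_ / ·) hlz')).trans (div_mul_div_comm _ _ _ _).symm).trans
    (congrArg₂ (· * ·) hf hg).symm

variable (Q) in
/-- The function `1 = P / P`. -/
def one (n : ℕ+) (P : Pole 𝓛) : MerC Q (n, P) :=
  isometry Q (n, P) (BHolC.ofEntire Q n P.differentiable)

theorem germ_one (n : ℕ+) (P : Pole 𝓛) : MerC.germ Q (n, P) (one Q n P) = 1 :=
  (germ_eq_iff (F := 1)).2 (Eventually.of_forall fun _ hz => div_self hz.2)

variable (Q) in
/-- The map `f ↦ (f * P) / P`. -/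
def ofHolo (P : Pole 𝓛) (n : ℕ+) : BHolC Q n →L[ℂ] MerC Q (n, P) :=
  (isometry Q (n, P) : BHolC Q n →L[ℂ] MerC Q (n, P)).comp
    (BHolC.mulLeft (BHolC.ofEntire Q n P.differentiable))

theorem germ_ofHolo (P : Pole 𝓛) (n : ℕ+) (f : BHolC Q n) :
    MerC.germ Q (n, P) (ofHolo Q P n f) = BHolC.germ Q 𝓛 n f := by
  refine germ_eq_iff.2 (Eventually.of_forall fun z hz => ?_)
  exact (mul_div_cancel_left₀ (f.1 ⟨z, hz.1⟩) hz.2).trans (BHolC.extend_apply f hz.1).symm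

end MerC

/-! ### The real subspaces -/

theorem isClosed_BHolR (n : ℕ+) : IsClosed (BHolR Q n : Set (BHolC Q n)) := by
  have : (BHolR Q n : Set (BHolC Q n)) = ⋂ (x : Fin k → ℝ) (hx : ofRealVec x ∈ ball Q n),
      {f | (f.1 ⟨_, hx⟩).im = 0} := by
    ext f
    simp only [Set.mem_iInter]
    rfl
  rw [this]
  refine isClosed_iInter fun x => isClosed_iInter fun hx => isClosed_eq ?_ continuous_const
  exact Complex.continuous_im.comp
    ((BoundedContinuousFunction.lipschitz_eval_const _).continuous.comp continuous_subtype_val)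

instance (n : ℕ+) : CompleteSpace (BHolR Q n) := (isClosed_BHolR Q n).completeSpace_coe

theorem mem_MerR_iff {i : Idx 𝓛} {u : MerC Q i} :
    u ∈ MerR Q i ↔ (MerC.isometry Q i).symm u ∈ BHolR Q i.1 := by
  constructor
  · rintro ⟨f, hf, rfl⟩
    have : (MerC.isometry Q i).symm (MerC.isometry Q i f) ∈ BHolR Q i.1 := by
      rwa [LinearIsometryEquiv.symm_apply_apply]
    exact this
  · exact fun h => ⟨_, h, (MerC.isometry Q i).apply_symm_apply u⟩

theorem isometry_mem_MerR {i : Idx 𝓛} {f : BHolC Q i.1} (hf : f ∈ BHolR Q i.1) :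
    MerC.isometry Q i f ∈ MerR Q i := ⟨f, hf, rfl⟩

theorem isClosed_MerR (i : Idx 𝓛) : IsClosed (MerR Q i : Set (MerC Q i)) := by
  have : (MerR Q i : Set (MerC Q i)) = (MerC.isometry Q i).symm ⁻¹' BHolR Q i.1 :=
    Set.ext fun _ => mem_MerR_iff Q
  rw [this]
  exact (isClosed_BHolR Q i.1).preimage (MerC.isometry Q i).symm.continuous

instance (i : Idx 𝓛) : CompleteSpace (MerR Q i) := (isClosed_MerR Q i).completeSpace_coe

theorem BHolR.mul_mem {n : ℕ+} {f g : BHolC Q n} (hf : f ∈ BHolR Q n) (hg : g ∈ BHolR Q n) :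
    f * g ∈ BHolR Q n := fun x hx => by
  rw [BHolC.mul_apply, Complex.mul_im, hf x hx, hg x hx]
  simp

theorem BHolR.res_mem {n m : ℕ+} (h : n ≤ m) {f : BHolC Q n} (hf : f ∈ BHolR Q n) :
    BHolC.res Q n m h f ∈ BHolR Q m := fun x hx => hf x (ball_mono Q h hx)

theorem BHolR.ofEntire_mem (n : ℕ+) (P : Pole 𝓛) :
    BHolC.ofEntire Q n P.differentiable ∈ BHolR Q n := fun x _ => P.real x

theorem MerR.mul_mem {i j l : Idx 𝓛} (hi : i.1 ≤ l.1) (hj : j.1 ≤ l.1) {u : MerC Q i}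
    {v : MerC Q j} (hu : u ∈ MerR Q i) (hv : v ∈ MerR Q j) : MerC.mul l hi hj u v ∈ MerR Q l :=
  isometry_mem_MerR Q (BHolR.mul_mem Q (BHolR.res_mem Q hi ((mem_MerR_iff Q).1 hu))
    (BHolR.res_mem Q hj ((mem_MerR_iff Q).1 hv)))

theorem MerR.ofHolo_mem (P : Pole 𝓛) {n : ℕ+} {f : BHolC Q n} (hf : f ∈ BHolR Q n) :
    MerC.ofHolo Q P n f ∈ MerR Q (n, P) :=
  isometry_mem_MerR Q (BHolR.mul_mem Q (BHolR.ofEntire_mem Q n P) hf)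

variable {Q}

theorem BHolR.continuous_res {n m : ℕ+} (h : n ≤ m) : Continuous (BHolR.res Q n m h) :=
  ((BHolC.continuous_res h).comp continuous_subtype_val).subtype_mk _

theorem BHolR.isCompactOperator_res {n m : ℕ+} (h : n < m) :
    IsCompactOperator (BHolR.res Q n m h.le) :=
  ((BHolC.isCompactOperator_res Q h).comp_clm (BHolR Q n).subtypeL).codRestrict
    (fun f => BHolR.res_mem Q h.le f.2) (isClosed_BHolR Q m)

theorem MerR.continuous_res {i j : Idx 𝓛} (h : i ≤ j) : Continuous (MerR.res Q i j h) :=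
  ((MerC.continuous_res h).comp continuous_subtype_val).subtype_mk _

theorem MerR.isCompactOperator_res {i j : Idx 𝓛} (h : i ≤ j) (hlt : i.1 < j.1) :
    IsCompactOperator (MerR.res Q i j h) :=
  ((MerC.isCompactOperator_res h hlt).comp_clm (MerR Q i).subtypeL).codRestrict
    (fun u => (MerR.res Q i j h u).2) (isClosed_MerR Q j)

variable (Q) in
/-- The map `f ↦ (f * P) / P` on the real subspaces. -/
def MerR.ofHolo (P : Pole 𝓛) (n : ℕ+) : BHolR Q n →ₗ[ℝ] MerR Q (n, P) :=
  ((MerC.ofHolo Q P n).toLinearMap.restrictScalars ℝ).restrict fun _ => MerR.ofHolo_mem Q P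

theorem MerR.continuous_ofHolo (P : Pole 𝓛) (n : ℕ+) : Continuous (MerR.ofHolo Q P n) :=
  ((MerC.ofHolo Q P n).continuous.comp continuous_subtype_val).subtype_mk _

end Steps

end Poles

section Limits

variable {k : ℕ} (Q : IP k) (𝓛 : GeneratingSet k)

/-! ### The inductive limits of meromorphic germs -/

variable {𝓛}

/-- The canonical map of a step into the complex inductive limit. -/
def MeroC.of (i : Idx 𝓛) : MerC Q i →ₗ[ℂ] MeroC Q 𝓛 :=
  LCLim.of ℂ (fun i : Idx 𝓛 => MerC Q i) (MerC.res Q) i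

/-- The canonical map of a step into the real inductive limit. -/
def MeroR.of (i : Idx 𝓛) : MerR Q i →ₗ[ℝ] MeroR Q 𝓛 :=
  LCLim.of ℝ (fun i : Idx 𝓛 => MerR Q i) (MerR.res Q) i

theorem MeroC.germ_of (i : Idx 𝓛) (u : MerC Q i) :
    MeroC.germ Q 𝓛 (MeroC.of Q i u) = MerC.germ Q i u :=
  LCLim.lift_of (X := fun i : Idx 𝓛 => MerC Q i) (b := MerC.res Q) (MerC.germ Q)
    (MerC.germ_res Q) i u

theorem MeroR.germ_of (i : Idx 𝓛) (u : MerR Q i) :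
    MeroR.germ Q 𝓛 (MeroR.of Q i u) = MerC.germ Q i u.1 :=
  LCLim.lift_of (X := fun i : Idx 𝓛 => MerR Q i) (b := MerR.res Q)
    (fun i => ((MerC.germ Q i).restrictScalars ℝ).comp (MerR Q i).subtype)
    (fun i j h u => MerC.germ_res Q i j h u.1) i u

variable (𝓛)

theorem MeroC.germ_injective : Function.Injective (MeroC.germ Q 𝓛) :=
  LCLim.lift_injective _ _ fun _ => MerC.germ_injective

theorem MeroR.germ_injective : Function.Injective (MeroR.germ Q 𝓛) :=
  LCLim.lift_injective _ _ fun _ _ _ h => Subtype.ext (MerC.germ_injective h)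

variable {𝓛} in
theorem MeroC.of_injective (i : Idx 𝓛) :
    Function.Injective (MeroC.of Q i) := fun u v h => by
  refine MerC.germ_injective ?_
  rw [← MeroC.germ_of, ← MeroC.germ_of, h]

variable {𝓛} in
theorem MeroR.of_injective (i : Idx 𝓛) :
    Function.Injective (MeroR.of Q i) := fun u v h => by
  refine Subtype.ext (MerC.germ_injective ?_)
  rw [← MeroR.germ_of, ← MeroR.germ_of, h]

theorem MeroC.isSilva : IsSilva ℂ (MeroC Q 𝓛) := by
  obtain ⟨a, ha, halt, hcof⟩ := exists_cofinal_seq 𝓛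
  exact LCLim.isSilva (fun _ _ h => MerC.continuous_res h) (MeroC.of_injective Q) ha hcof
    fun n => MerC.isCompactOperator_res _ (halt n)

theorem MeroR.isSilva : IsSilva ℝ (MeroR Q 𝓛) := by
  obtain ⟨a, ha, halt, hcof⟩ := exists_cofinal_seq 𝓛
  exact LCLim.isSilva (fun _ _ h => MerR.continuous_res h) (MeroR.of_injective Q) ha hcof
    fun n => MerR.isCompactOperator_res _ (halt n)

theorem MeroC.isPointwiseLCAlgebra : IsPointwiseLCAlgebra ℂ (MeroC.germ Q 𝓛) := by
  obtain ⟨a, -, -, hcof⟩ := exists_cofinal_seq 𝓛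
  have P : Pole 𝓛 := Classical.arbitrary _
  refine LCLim.isPointwiseLCAlgebra (fun _ _ h => MerC.continuous_res h) hcof _
    (MeroC.germ_injective Q 𝓛)
    ⟨MeroC.of Q (1, P) (MerC.one Q 1 P), (MeroC.germ_of Q _ _).trans (MerC.germ_one 1 P)⟩
    germ_smul_mul fun i j => ?_
  let l : Idx 𝓛 := (max i.1 j.1, i.2 * j.2)
  have hi : i.1 ≤ l.1 := le_max_left _ _
  have hj : j.1 ≤ l.1 := le_max_right _ _
  refine ⟨l, MerC.mul l hi hj, 1,
    fun u v => (MerC.norm_mul_le hi hj u v).trans_eq (one_mul _).symm, fun u v => ?_⟩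
  refine (MeroC.germ_of Q l _).trans ((MerC.germ_mul hi hj rfl u v).trans ?_)
  exact (congrArg₂ (· * ·) (MeroC.germ_of Q i u) (MeroC.germ_of Q j v)).symm

theorem MeroR.isPointwiseLCAlgebra : IsPointwiseLCAlgebra ℝ (MeroR.germ Q 𝓛) := by
  obtain ⟨a, -, -, hcof⟩ := exists_cofinal_seq 𝓛
  have P : Pole 𝓛 := Classical.arbitrary _
  refine LCLim.isPointwiseLCAlgebra (fun _ _ h => MerR.continuous_res h) hcof _
    (MeroR.germ_injective Q 𝓛)
    ⟨MeroR.of Q (1, P) ⟨MerC.one Q 1 P, isometry_mem_MerR Q (BHolR.ofEntire_mem Q 1 P)⟩,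
      (MeroR.germ_of Q _ _).trans (MerC.germ_one 1 P)⟩
    germ_smul_mul fun i j => ?_
  let l : Idx 𝓛 := (max i.1 j.1, i.2 * j.2)
  have hi : i.1 ≤ l.1 := le_max_left _ _
  have hj : j.1 ≤ l.1 := le_max_right _ _
  refine ⟨l, fun u v => ⟨MerC.mul l hi hj u.1 v.1, MerR.mul_mem Q hi hj u.2 v.2⟩, 1,
    fun u v => (MerC.norm_mul_le hi hj u.1 v.1).trans_eq (one_mul _).symm, fun u v => ?_⟩
  refine (MeroR.germ_of Q l _).trans ((MerC.germ_mul hi hj rfl u.1 v.1).trans ?_)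
  exact (congrArg₂ (· * ·) (MeroR.germ_of Q i u) (MeroR.germ_of Q j v)).symm

/-! ### The inductive limits of holomorphic germs -/

theorem HoloC.exists_toMero : ∃ j : HoloC Q →L[ℂ] MeroC Q 𝓛, Function.Injective j ∧
    ∀ (n : ℕ+) (f : BHolC Q n),
      MeroC.germ Q 𝓛 (j (HoloC.of Q n f)) = BHolC.germ Q 𝓛 n f := by
  have P : Pole 𝓛 := Classical.arbitrary _
  exact LCLim.exists_continuous_injective (MeroC.germ_injective Q 𝓛)
    (fun _ => BHolC.germ_injective) (fun _ _ h f => BHolC.germ_res h f) (fun n => (n, P))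
    (fun n => (MerC.ofHolo Q P n).toLinearMap) (fun n => (MerC.ofHolo Q P n).continuous)
    fun n f => (MeroC.germ_of Q (n, P) _).trans (MerC.germ_ofHolo P n f)

theorem HoloR.exists_toMero : ∃ j : HoloR Q →L[ℝ] MeroR Q 𝓛, Function.Injective j ∧
    ∀ (n : ℕ+) (f : BHolR Q n),
      MeroR.germ Q 𝓛 (j (HoloR.of Q n f)) = BHolC.germ Q 𝓛 n f.1 := by
  have P : Pole 𝓛 := Classical.arbitrary _
  exact LCLim.exists_continuous_injective (MeroR.germ_injective Q 𝓛)
    (δ := fun n (f : BHolR Q n) => BHolC.germ Q 𝓛 n f.1)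
    (fun _ => BHolC.germ_injective.comp Subtype.val_injective)
    (fun _ _ h f => BHolC.germ_res h f.1) (fun n => (n, P))
    (fun n => MerR.ofHolo Q P n) (fun n => MerR.continuous_ofHolo P n)
    fun n f => (MeroR.germ_of Q (n, P) _).trans (MerC.germ_ofHolo P n f.1)

theorem exists_le_succPNat (n : ℕ+) : ∃ m : ℕ, n ≤ m.succPNat :=
  ⟨n.natPred, (PNat.succPNat_natPred n).ge⟩

theorem monotone_succPNat : Monotone Nat.succPNat := fun _ _ h => Nat.succPNat_le_succPNat.2 h

/-- The generating set enters only through the germs from which the injectivity of the steps is read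
off. -/
theorem HoloC.isSilva (𝓛 : GeneratingSet k) : IsSilva ℂ (HoloC Q) := by
  have hinj (n : ℕ+) : Function.Injective (HoloC.of Q n) := by
    obtain ⟨j, -, hj⟩ := HoloC.exists_toMero Q 𝓛
    intro f g h
    refine BHolC.germ_injective (𝓛 := 𝓛) ?_
    rw [← hj, ← hj]
    exact congrArg (fun x => MeroC.germ Q 𝓛 (j x)) h
  exact LCLim.isSilva (fun _ _ h => BHolC.continuous_res h) hinj monotone_succPNat
    exists_le_succPNat fun n =>
      BHolC.isCompactOperator_res Q (Nat.succPNat_lt_succPNat.2 n.lt_succ_self)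

theorem HoloR.isSilva (𝓛 : GeneratingSet k) : IsSilva ℝ (HoloR Q) := by
  have hinj (n : ℕ+) : Function.Injective (HoloR.of Q n) := by
    obtain ⟨j, -, hj⟩ := HoloR.exists_toMero Q 𝓛
    intro f g h
    refine Subtype.ext (BHolC.germ_injective (𝓛 := 𝓛) ?_)
    rw [← hj, ← hj]
    exact congrArg (fun x => MeroR.germ Q 𝓛 (j x)) h
  exact LCLim.isSilva (fun _ _ h => BHolR.continuous_res h) hinj monotone_succPNat
    exists_le_succPNat fun n =>
      BHolR.isCompactOperator_res (Nat.succPNat_lt_succPNat.2 n.lt_succ_self)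

end Limits

end SilvaGerms

end

theorem proposition1p6 (k : ℕ) (hk : 1 ≤ k)
    (Q : InnerProductSpace.Core ℂ (Fin k → ℂ))
    (hQ : ∀ x y : Fin k → ℝ, (Q.inner (ofRealVec x) (ofRealVec y)).im = 0)
    (𝓛 : GeneratingSet k) :
    -- the complex inductive limit
    (T2Space (MeroC Q 𝓛) ∧ IsCompleteTVS (MeroC Q 𝓛) ∧ IsSilva ℂ (MeroC Q 𝓛) ∧
      IsPointwiseLCAlgebra ℂ (MeroC.germ Q 𝓛)) ∧
    -- the real inductive limit
    (T2Space (MeroR Q 𝓛) ∧ IsCompleteTVS (MeroR Q 𝓛) ∧ IsSilva ℝ (MeroR Q 𝓛) ∧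
      IsPointwiseLCAlgebra ℝ (MeroR.germ Q 𝓛)) ∧
    -- complex holomorphic germs and their canonical continuous injection
    (IsSilva ℂ (HoloC Q) ∧
      ∃ j : HoloC Q →L[ℂ] MeroC Q 𝓛, Function.Injective j ∧
        ∀ (n : ℕ+) (f : BHolC Q n),
          MeroC.germ Q 𝓛 (j (HoloC.of Q n f)) = BHolC.germ Q 𝓛 n f) ∧
    -- real holomorphic germs and their canonical continuous injection
    (IsSilva ℝ (HoloR Q) ∧
      ∃ j : HoloR Q →L[ℝ] MeroR Q 𝓛, Function.Injective j ∧
        ∀ (n : ℕ+) (f : BHolR Q n),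
          MeroR.germ Q 𝓛 (j (HoloR.of Q n f)) = BHolC.germ Q 𝓛 n f.1) :=
  ⟨⟨(MeroC.isSilva Q 𝓛).t2Space, (MeroC.isSilva Q 𝓛).isCompleteTVS, MeroC.isSilva Q 𝓛,
      MeroC.isPointwiseLCAlgebra Q 𝓛⟩,
    ⟨(MeroR.isSilva Q 𝓛).t2Space, (MeroR.isSilva Q 𝓛).isCompleteTVS, MeroR.isSilva Q 𝓛,
      MeroR.isPointwiseLCAlgebra Q 𝓛⟩,
    ⟨HoloC.isSilva Q 𝓛, HoloC.exists_toMero Q 𝓛⟩,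
    ⟨HoloR.isSilva Q 𝓛, HoloR.exists_toMero Q 𝓛⟩⟩
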